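/- Let $0<s<1$ and $n\ge 2$. Let $u:\mathbb{R}^n\times\mathbb{R}\to\mathbb{R}$ belong to $$\mathcal{L}^{2s,s}(\mathbb{R}^n\times\mathbb{R})=\left\{u\in L^1_{\rm loc}(\mathbb{R}^n\times\mathbb{R})\ :\ \int_{-\infty}^{+\infty}\int_{\mathbb{R}^n}\frac{|u(x,t)|}{1+|x|^{n+2+2s}+|t|^{\frac n2+1+s}}\,dx\,dt<\infty\right\},$$ and suppose that $(\partial_t-\Delta)^s u=0$ on $\mathbb{R}^n\times\mathbb{R}$ in the sense of distributions, that is, $$\int_{-\infty}^{+\infty}\int_{\mathbb{R}^n}u(x,t)\,\overline{(\partial_t-\Delta)^s_{\rm right}\varphi(x,t)}\,dx\,dt=0\qquad\text{for every complex-valued Schwartz function }\varphi\in\mathcal{S}(\mathbb{R}^n\times\mathbb{R}),$$ where $$(\partial_t-\Delta)^s_{\rm right}\varphi(x,t)=\frac{1}{(4\pi)^{n/2}|\Gamma(-s)|}\int_t^{+\infty}\left(\int_{\mathbb{R}^n}\frac{\varphi(x,t)-\varphi(y,\tau)}{(\tau-t)^{\frac n2+1+s}}\,e^{-\frac{|x-y|^2}{4(\tau-t)}}\,dy\right)d\tau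 .$$ If $\frac12<s<1$, assume in addition that there is some $\gamma\in[0,1]$ such that either $$\liminf_{|x|\to\infty}\frac{u(x,t)}{|x|^\gamma}\ge 0\ \text{ for almost every } t\in\mathbb{R},\qquad\text{or}\qquad \limsup_{|x|\to\infty}\frac{u(x,t)}{|x|^\gamma}\le 0\ \text{ for almost every } t\in\mathbb{R},$$ where the lower and upper limits may be taken in the essential sense, i.e. disregarding a Lebesgue null set of $x$ for each $t$. Then $u$ is constant: there is $c\in\mathbb{R}$ with $u(x,t)=c$ for almost every $(x,t)\in\mathbb{R}^n\times\mathbb{R}$. -/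

import Mathlib

open MeasureTheory Filter Set
open scoped SchwartzMap

noncomputable section

namespace MasterEquation

/-- Space-time `ℝⁿ × ℝ`; a point is a pair `(x, t)`, and `‖x‖` is the Euclidean norm of `x`. -/
abbrev SpaceTime (n : ℕ) : Type := EuclideanSpace ℝ (Fin n) × ℝ

/-- The weight `1 + |x|^(n+2+2s) + |t|^(n/2+1+s)`. -/
def weight (n : ℕ) (s : ℝ) (p : SpaceTime n) : ℝ :=
  1 + ‖p.1‖ ^ ((n : ℝ) + 2 + 2 * s) + |p.2| ^ ((n : ℝ) / 2 + 1 + s)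

/-- `u` belongs to the slowly increasing function space `𝓛^{2s,s}(ℝⁿ × ℝ)`. -/
def MemSlowlyIncreasing (n : ℕ) (s : ℝ) (u : SpaceTime n → ℝ) : Prop :=
  LocallyIntegrable u volume ∧ Integrable (fun p => |u p| / weight n s p) volume

/-- The normalization constant `C_{n,s} = 1 / ((4π)^(n/2) |Γ(-s)|)`. -/
def normConst (n : ℕ) (s : ℝ) : ℝ :=
  1 / ((4 * Real.pi) ^ ((n : ℝ) / 2) * |Real.Gamma (-s)|)

/-- The right fractional operator `(∂ₜ - Δ)^s_right φ` at `p = (x, t)`: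
`C_{n,s} ∫_t^∞ ∫_{ℝⁿ} (φ(x,t) - φ(y,τ)) / (τ-t)^(n/2+1+s) * exp(-|x-y|² / (4(τ-t))) dy dτ`.
It is the iterated integral, first in `y` and then in `τ`. For a Schwartz function `φ` and
`τ > t` the integral in `y` converges absolutely, because of the Gaussian factor, and therefore
equals its Cauchy principal value; for `0 < s < 1` its value is `O((τ-t)^(-s))` as `τ → t` and
`O((τ-t)^(-1-s))` as `τ → ∞`, so that the integral in `τ` converges absolutely as well. -/
def rightOp (n : ℕ) (s : ℝ) (φ : SpaceTime n → ℂ) (p : SpaceTime n) : ℂ :=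
  (normConst n s : ℂ) * ∫ τ in Ioi p.2, ∫ y : EuclideanSpace ℝ (Fin n),
    ((Real.exp (-(‖p.1 - y‖ ^ 2) / (4 * (τ - p.2))) /
      (τ - p.2) ^ ((n : ℝ) / 2 + 1 + s) : ℝ) : ℂ) * (φ p - φ (y, τ))

/-- `u` solves `(∂ₜ - Δ)^s u = 0` on `ℝⁿ × ℝ` in the sense of distributions. -/
def IsDistributionalSolution (n : ℕ) (s : ℝ) (u : SpaceTime n → ℝ) : Prop :=
  ∀ φ : 𝓢(SpaceTime n, ℂ),
    ∫ p, (u p : ℂ) * (starRingEnd ℂ) (rightOp n s φ p) = 0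

/-- The filter of `|x| → ∞` up to Lebesgue null sets: a property holds eventually along it iff
there is `R` such that it holds for almost every `x` with `|x| > R`. Lower and upper limits along
it are essential ones, which are the meaningful ones for a locally integrable function. -/
def essAtInfty (n : ℕ) : Filter (EuclideanSpace ℝ (Fin n)) :=
  Bornology.cobounded (EuclideanSpace ℝ (Fin n)) ⊓ ae volume

/-- `liminf_{|x|→∞} u(x,t) / |x|^γ ≥ 0` for almost every `t`. -/
def GrowthBelow (n : ℕ) (γ : ℝ) (u : SpaceTime n → ℝ) : Prop :=
  ∀ᵐ t : ℝ, 0 ≤ liminf (fun x => ((u (x, t) / ‖x‖ ^ γ : ℝ) : EReal)) (essAtInfty n)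

/-- `limsup_{|x|→∞} u(x,t) / |x|^γ ≤ 0` for almost every `t`. -/
def GrowthAbove (n : ℕ) (γ : ℝ) (u : SpaceTime n → ℝ) : Prop :=
  ∀ᵐ t : ℝ, limsup (fun x => ((u (x, t) / ‖x‖ ^ γ : ℝ) : EReal)) (essAtInfty n) ≤ 0

end MasterEquation

end

noncomputable section

namespace MasterEquation

open scoped Topology ContDiff Pointwise

variable {n : ℕ}

/-! The idea is to invert the operator on test functions approximately and let the error tend to
zero. Let `P_v` be the backward heat semigroup. The formal inverse of the right operator is a
multiple of `∫₀^∞ σ^(s-1) P_σ ψ dσ`, which need not be Schwartz. Cutting the integral off smoothly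
at time scale `T` gives a Schwartz function (`truncPotential`), which may be inserted in the
definition of a solution.

Along the semigroup the right operator is a Marchaud derivative in `v`. Fubini and an Abel integral
(`integral_marchaud`) show that it maps the truncated potential to a constant times `H(0) ψ + ∫ T⁻¹
H'(v/T) P_v ψ dv`, where `H` is `profile s` (`rightOp_truncPotential`). Without the cutoff `H` would
be constant, so the second term is an error carried by `v ≥ T`, and there `|H'(v/T)| ≤ C
(v/T)^(-1-s)`.

If `ψ` has vanishing moments against `1` and the `x_j`, a parabolic Taylor expansion of the heat
kernel gains a factor `1/v`: one time derivative costs as much as two space derivatives, so no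
moment in `t` is needed. With `v ≥ T` the error is then `O(T^(s-1))` times the inverse of the weight
(`exists_error_le`). This is the weight against which `u` is integrable, hence `T → ∞` gives `∫ u ψ
= 0` (`integral_mul_eq_zero`).

A functional that vanishes on the common kernel of finitely many functionals lies in their span.
Therefore `u = a + ⟨b, x⟩` almost everywhere (`exists_ae_eq_affine`). If `s ≤ 1/2`, a nonzero `b`
contradicts the integrability against the weight; if `s > 1/2`, it contradicts the one-sided growth
condition, since `γ ≤ 1`. -/

/-! ### The heat kernel and the backward heat semigroup. -/

/-- The Gauss-Weierstrass kernel `(4πv)^(-n/2) exp(-|y|²/(4v))`. -/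
def heatKernel (n : ℕ) (v : ℝ) (y : EuclideanSpace ℝ (Fin n)) : ℝ :=
  (4 * Real.pi * v) ^ (-(n : ℝ) / 2) * Real.exp (-‖y‖ ^ 2 / (4 * v))

lemma heatKernel_nonneg {v : ℝ} (hv : 0 ≤ v) (y : EuclideanSpace ℝ (Fin n)) :
    0 ≤ heatKernel n v y := by
  unfold heatKernel; positivity

lemma continuous_heatKernel (v : ℝ) : Continuous (heatKernel n v) := by
  unfold heatKernel; fun_prop

lemma heatKernel_neg (v : ℝ) (y : EuclideanSpace ℝ (Fin n)) :
    heatKernel n v (-y) = heatKernel n v y := by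
  simp [heatKernel]

lemma integrable_exp_neg_mul_sq_norm {b : ℝ} (hb : 0 < b) :
    Integrable (fun y : EuclideanSpace ℝ (Fin n) => Real.exp (-b * ‖y‖ ^ 2)) := by
  have h := (GaussianFourier.integrable_cexp_neg_mul_sq_norm_add
    (V := EuclideanSpace ℝ (Fin n)) (b := (b : ℂ)) (by simpa) 0 0).norm
  refine h.congr (Eventually.of_forall fun y => ?_)
  simp only [Complex.norm_exp]
  norm_cast
  simp

lemma integrable_heatKernel {v : ℝ} (hv : 0 < v) : Integrable (heatKernel n v) := by
  refine ((integrable_exp_neg_mul_sq_norm (n := n) (b := 1 / (4 * v))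
    (by positivity)).const_mul ((4 * Real.pi * v) ^ (-(n : ℝ) / 2))).congr
    (Eventually.of_forall fun y => ?_)
  simp only [heatKernel]
  congr 2
  field_simp

lemma integral_heatKernel {v : ℝ} (hv : 0 < v) : ∫ y, heatKernel n v y = 1 := by
  have h := GaussianFourier.integral_rexp_neg_mul_sq_norm
    (V := EuclideanSpace ℝ (Fin n)) (b := 1 / (4 * v)) (by positivity)
  have e : heatKernel n v = fun y => (4 * Real.pi * v) ^ (-(n : ℝ) / 2) *
      Real.exp (-(1 / (4 * v)) * ‖y‖ ^ 2) := by
    funext y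
    simp only [heatKernel]
    congr 2
    field_simp
  rw [e, integral_const_mul, h]
  have : Real.pi / (1 / (4 * v)) = 4 * Real.pi * v := by field_simp
  rw [this, finrank_euclideanSpace_fin, ← Real.rpow_add (by positivity)]
  rw [show -(n : ℝ) / 2 + n / 2 = 0 by ring, Real.rpow_zero]

/-- Completing the square in `z`. The second factor on the right is a Gaussian of mass one in `z`,
so integrating it out leaves the semigroup law. -/
lemma heatKernel_mul_heatKernel {σ τ : ℝ} (hσ : 0 < σ) (hτ : 0 < τ)
    (w z : EuclideanSpace ℝ (Fin n)) :
    heatKernel n τ (w - z) * heatKernel n σ z =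
      heatKernel n (τ + σ) w * heatKernel n (σ * τ / (σ + τ)) (z - (σ / (σ + τ)) • w) := by
  have hs : 0 < σ + τ := by positivity
  have hw : ‖w - z‖ ^ 2 = ‖w‖ ^ 2 - 2 * inner ℝ w z + ‖z‖ ^ 2 := norm_sub_sq_real w z
  have hz : ‖z - (σ / (σ + τ)) • w‖ ^ 2 =
      ‖z‖ ^ 2 - 2 * ((σ / (σ + τ)) * inner ℝ w z) + (σ / (σ + τ)) ^ 2 * ‖w‖ ^ 2 := by
    rw [norm_sub_sq_real, inner_smul_right, real_inner_comm, norm_smul, mul_pow, Real.norm_eq_abs,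
      sq_abs]
  unfold heatKernel
  rw [mul_mul_mul_comm, ← Real.exp_add, mul_mul_mul_comm, ← Real.exp_add, hw, hz,
    ← Real.mul_rpow (by positivity) (by positivity),
    ← Real.mul_rpow (by positivity) (by positivity)]
  congr 2
  · field_simp; ring
  · field_simp; ring

lemma integral_heatKernel_mul_heatKernel {σ τ : ℝ} (hσ : 0 < σ) (hτ : 0 < τ)
    (w : EuclideanSpace ℝ (Fin n)) :
    ∫ z, heatKernel n τ (w - z) * heatKernel n σ z = heatKernel n (τ + σ) w := by
  simp_rw [heatKernel_mul_heatKernel hσ hτ]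
  rw [integral_const_mul, integral_sub_right_eq_self, integral_heatKernel (by positivity), mul_one]

/-- Parabolic scaling. Moving `v` from the kernel into the argument of `g` allows one dominating
function for all `v`, including `v = 0`. -/
lemma integral_heatKernel_mul {v : ℝ} (hv : 0 < v) (g : EuclideanSpace ℝ (Fin n) → ℝ) :
    ∫ y, heatKernel n v y * g y = ∫ y, heatKernel n 1 y * g (√v • y) := by
  have h := Measure.integral_comp_smul (μ := (volume : Measure (EuclideanSpace ℝ (Fin n))))
    (fun y => heatKernel n v y * g y) (√v)
  have hr : 0 < √v := Real.sqrt_pos.2 hv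
  rw [finrank_euclideanSpace_fin, abs_of_pos (by positivity), smul_eq_mul] at h
  have e : ∀ y, heatKernel n v (√v • y) * g (√v • y) =
      (√v ^ n)⁻¹ * (heatKernel n 1 y * g (√v • y)) := by
    intro y
    rw [← mul_assoc]
    congr 1
    unfold heatKernel
    rw [norm_smul, Real.norm_of_nonneg hr.le, mul_pow, Real.sq_sqrt hv.le, ← mul_assoc, mul_one,
      mul_one, show -(v * ‖y‖ ^ 2) = -‖y‖ ^ 2 * v by ring,
      mul_div_mul_right _ _ hv.ne', Real.mul_rpow (by positivity) hv.le]
    congr 1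
    rw [mul_comm, Real.sqrt_eq_rpow, ← Real.rpow_natCast, ← Real.rpow_mul hv.le,
      ← Real.rpow_neg hv.le]
    congr 2
    ring
  simp_rw [e] at h
  rw [integral_const_mul] at h
  exact (mul_left_cancel₀ (by positivity) h).symm

/-- Powers are dominated by exponentials. -/
lemma exists_rpow_mul_exp_neg_le {a b : ℝ} (ha : 0 ≤ a) (hb : 0 < b) :
    ∃ C : ℝ, 0 ≤ C ∧ ∀ r : ℝ, 0 ≤ r → r ^ a * Real.exp (-b * r) ≤ C := by
  have h := tendsto_rpow_mul_exp_neg_mul_atTop_nhds_zero a b hb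
  have hc : ContinuousOn (fun r : ℝ => r ^ a * Real.exp (-b * r)) (Ici 0) := by
    apply ContinuousOn.mul
    · exact (Real.continuous_rpow_const ha).continuousOn
    · fun_prop
  obtain ⟨R, hR⟩ := eventually_atTop.1 (h.eventually (gt_mem_nhds zero_lt_one))
  obtain ⟨C, hC⟩ := (isCompact_Icc (a := (0 : ℝ)) (b := R)).exists_bound_of_continuousOn
    (hc.mono Icc_subset_Ici_self)
  refine ⟨max C 1, by positivity, fun r hr => ?_⟩
  rcases le_total r R with h1 | h1
  · exact (le_abs_self _).trans ((hC r ⟨hr, h1⟩).trans (le_max_left _ _))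
  · exact (hR r h1).le.trans (le_max_right _ _)

lemma integrable_heatKernel_one_mul_pow (k : ℕ) :
    Integrable (fun y : EuclideanSpace ℝ (Fin n) => heatKernel n 1 y * ‖y‖ ^ k) := by
  obtain ⟨C, hC0, hC⟩ := exists_rpow_mul_exp_neg_le (a := k / 2) (b := 1 / 8)
    (by positivity) (by norm_num)
  refine ((integrable_exp_neg_mul_sq_norm (n := n) (b := 1 / 8) (by norm_num)).const_mul
    ((4 * Real.pi * 1) ^ (-(n : ℝ) / 2) * C)).mono' ?_ (Eventually.of_forall fun y => ?_)
  · exact ((continuous_heatKernel 1).mul (by fun_prop)).aestronglyMeasurable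
  · rw [Real.norm_of_nonneg (mul_nonneg (heatKernel_nonneg zero_le_one y) (by positivity))]
    have h1 := hC (‖y‖ ^ 2) (by positivity)
    have h2 : (‖y‖ ^ 2) ^ ((k : ℝ) / 2) = ‖y‖ ^ k := by
      rw [← Real.rpow_natCast, ← Real.rpow_mul (norm_nonneg _), ← Real.rpow_natCast]
      congr 1
      push_cast
      ring
    rw [h2] at h1
    have h3 : Real.exp (-‖y‖ ^ 2 / (4 * 1)) =
        Real.exp (-(1 / 8) * ‖y‖ ^ 2) * Real.exp (-(1 / 8) * ‖y‖ ^ 2) := by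
      rw [← Real.exp_add]; congr 1; ring
    unfold heatKernel
    rw [h3]
    calc _ = (4 * Real.pi * 1) ^ (-(n : ℝ) / 2) * (‖y‖ ^ k * Real.exp (-(1 / 8) * ‖y‖ ^ 2)) *
          Real.exp (-(1 / 8) * ‖y‖ ^ 2) := by ring
      _ ≤ _ := by gcongr

/-- The backward heat semigroup `P_v` on space-time:
`(P_v ψ)(x,t) = ∫ G_v(y) ψ(x - y, t + v) dy`, written so that it makes sense for `v = 0`. -/
def heatAvg (ψ : SpaceTime n → ℝ) (v : ℝ) (p : SpaceTime n) : ℝ :=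
  ∫ y, heatKernel n 1 y * ψ (p.1 - √v • y, p.2 + v)

lemma heatAvg_eq_integral_sub (ψ : SpaceTime n → ℝ) {v : ℝ} (hv : 0 < v) (p : SpaceTime n) :
    heatAvg ψ v p = ∫ y, heatKernel n v y * ψ (p.1 - y, p.2 + v) :=
  (integral_heatKernel_mul hv fun y => ψ (p.1 - y, p.2 + v)).symm

lemma heatAvg_eq_integral (ψ : SpaceTime n → ℝ) {v : ℝ} (hv : 0 < v) (p : SpaceTime n) :
    heatAvg ψ v p = ∫ z, heatKernel n v (p.1 - z) * ψ (z, p.2 + v) := by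
  rw [heatAvg_eq_integral_sub ψ hv,
    ← integral_sub_left_eq_self (fun z => heatKernel n v (p.1 - z) * ψ (z, p.2 + v)) _ p.1]
  simp

lemma heatAvg_zero (ψ : SpaceTime n → ℝ) (p : SpaceTime n) : heatAvg ψ 0 p = ψ p := by
  simp [heatAvg, integral_mul_const, integral_heatKernel]

lemma norm_heatKernel_mul_le {ψ : SpaceTime n → ℝ} {C : ℝ} (hb : ∀ q, |ψ q| ≤ C) {v : ℝ}
    (hv : 0 ≤ v) (y : EuclideanSpace ℝ (Fin n)) (q : SpaceTime n) :
    ‖heatKernel n v y * ψ q‖ ≤ heatKernel n v y * C := by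
  rw [norm_mul, Real.norm_of_nonneg (heatKernel_nonneg hv y)]
  exact mul_le_mul_of_nonneg_left (hb q) (heatKernel_nonneg hv y)

lemma continuous_heatAvg {ψ : SpaceTime n → ℝ} (hc : Continuous ψ) {C : ℝ}
    (hb : ∀ q, |ψ q| ≤ C) : Continuous fun q : ℝ × SpaceTime n => heatAvg ψ q.1 q.2 := by
  refine continuous_of_dominated (bound := fun y => heatKernel n 1 y * C) (fun q => ?_)
    (fun q => Eventually.of_forall fun y => norm_heatKernel_mul_le hb zero_le_one _ _)
    ((integrable_heatKernel zero_lt_one).mul_const C) (Eventually.of_forall fun y => ?_)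
  · exact ((continuous_heatKernel 1).mul (hc.comp (by fun_prop))).aestronglyMeasurable
  · exact continuous_const.mul (hc.comp (by fun_prop))

lemma abs_heatAvg_le {ψ : SpaceTime n → ℝ} {C : ℝ}
    (hb : ∀ q, |ψ q| ≤ C) (v : ℝ) (p : SpaceTime n) : |heatAvg ψ v p| ≤ C := by
  have h := norm_integral_le_of_norm_le ((integrable_heatKernel (n := n) zero_lt_one).mul_const C)
    (Eventually.of_forall fun y =>
      norm_heatKernel_mul_le hb zero_le_one y (p.1 - √v • y, p.2 + v))
  rwa [integral_mul_const, integral_heatKernel zero_lt_one, one_mul] at h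

lemma heatAvg_eq_zero {ψ : SpaceTime n → ℝ} {R : ℝ} (hR : ∀ q : SpaceTime n, R < |q.2| → ψ q = 0)
    {v : ℝ} {p : SpaceTime n} (h : R < |p.2 + v|) : heatAvg ψ v p = 0 := by
  unfold heatAvg
  simp [hR (_, p.2 + v) h]

/-- Semigroup law: Fubini, then the convolution identity for Gaussians. Absolute integrability comes
from the convolution of the two kernels, as `ψ` is bounded. -/
lemma heatAvg_heatAvg {ψ : SpaceTime n → ℝ} (hc : Continuous ψ) {C : ℝ}
    (hb : ∀ q, |ψ q| ≤ C) {σ τ : ℝ} (hσ : 0 < σ) (hτ : 0 < τ) (p : SpaceTime n) :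
    ∫ y, heatKernel n τ (p.1 - y) * heatAvg ψ σ (y, p.2 + τ) = heatAvg ψ (τ + σ) p := by
  have hi : Integrable (fun q : EuclideanSpace ℝ (Fin n) × EuclideanSpace ℝ (Fin n) =>
      heatKernel n τ (p.1 - q.1) *
        (heatKernel n σ (q.1 - q.2) * ψ (q.2, p.2 + τ + σ))) := by
    have h1 : Integrable (fun y => heatKernel n τ (p.1 - y)) :=
      (integrable_heatKernel hτ).comp_sub_left p.1
    have h2 := (h1.convolution_integrand (ContinuousLinearMap.mul ℝ ℝ)
      (integrable_heatKernel (n := n) hσ)).swap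
    refine (h2.mul_const C).mono' ?_ ?_
    · refine Continuous.aestronglyMeasurable ?_
      exact ((continuous_heatKernel τ).comp (by fun_prop)).mul
        (((continuous_heatKernel σ).comp (by fun_prop)).mul (hc.comp (by fun_prop)))
    · refine Eventually.of_forall fun q => ?_
      rw [norm_mul, Real.norm_of_nonneg (heatKernel_nonneg hτ.le _)]
      simp only [Function.comp_apply, Prod.fst_swap, Prod.snd_swap,
        ContinuousLinearMap.mul_apply']
      rw [← neg_sub q.1 q.2, heatKernel_neg, mul_assoc]
      exact mul_le_mul_of_nonneg_left (norm_heatKernel_mul_le hb hσ.le _ _)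
        (heatKernel_nonneg hτ.le _)
  calc ∫ y, heatKernel n τ (p.1 - y) * heatAvg ψ σ (y, p.2 + τ)
      = ∫ y, ∫ z, heatKernel n τ (p.1 - y) *
        (heatKernel n σ (y - z) * ψ (z, p.2 + τ + σ)) := by
        simp_rw [heatAvg_eq_integral ψ hσ, integral_const_mul]
    _ = ∫ z, ∫ y, heatKernel n τ (p.1 - y) *
        (heatKernel n σ (y - z) * ψ (z, p.2 + τ + σ)) := integral_integral_swap hi
    _ = ∫ z, heatKernel n (τ + σ) (p.1 - z) * ψ (z, p.2 + (τ + σ)) := by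
        congr 1
        funext z
        simp_rw [← mul_assoc, integral_mul_const]
        rw [← integral_heatKernel_mul_heatKernel hσ hτ (p.1 - z), add_assoc,
          ← integral_sub_right_eq_self
            (fun y => heatKernel n τ (p.1 - z - y) * heatKernel n σ y) z]
        simp
    _ = _ := (heatAvg_eq_integral ψ (by positivity) p).symm

/-- The curve `v ↦ (x - √v y, t + v)` has speed at most `1 + ‖y‖ / √v`, and the Gaussian has a
finite first moment. The singularity `1/√v` is integrable at `0`, which is all that the Marchaud
formula needs. -/
lemma exists_abs_deriv_heatAvg_le {ψ : SpaceTime n → ℝ} (hψ : ContDiff ℝ 1 ψ) {C : ℝ}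
    (hb : ∀ q, |ψ q| ≤ C) (hd : ∀ q, ‖fderiv ℝ ψ q‖ ≤ C) :
    ∃ C' : ℝ, 0 ≤ C' ∧ ∀ (p : SpaceTime n) (v : ℝ), 0 < v →
      DifferentiableAt ℝ (fun v => heatAvg ψ v p) v ∧
      |deriv (fun v => heatAvg ψ v p) v| ≤ C' * (1 + 1 / √v) := by
  have hC0 : 0 ≤ C := (abs_nonneg _).trans (hb 0)
  have hG := integrable_heatKernel (n := n) zero_lt_one
  have hG1 : Integrable (fun y : EuclideanSpace ℝ (Fin n) => heatKernel n 1 y * ‖y‖) := by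
    simpa using integrable_heatKernel_one_mul_pow (n := n) 1
  set M := ∫ y : EuclideanSpace ℝ (Fin n), heatKernel n 1 y * ‖y‖
  have hM : 0 ≤ M := integral_nonneg fun y =>
    mul_nonneg (heatKernel_nonneg zero_le_one y) (norm_nonneg _)
  have hdiff : Differentiable ℝ ψ := hψ.differentiable (by norm_num)
  have hbound : ∀ (v : ℝ), 0 < v → ∀ y : EuclideanSpace ℝ (Fin n), ∀ q,
      ‖heatKernel n 1 y * fderiv ℝ ψ q (-((1 / (2 * √v)) • y), 1)‖ ≤
        C * (heatKernel n 1 y + (heatKernel n 1 y * ‖y‖) * (1 / √v)) := by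
    intro v hv y q
    have hs : 0 < √v := Real.sqrt_pos.2 hv
    rw [norm_mul, Real.norm_of_nonneg (heatKernel_nonneg zero_le_one y)]
    have h1 : ‖((-((1 / (2 * √v)) • y), 1) : SpaceTime n)‖ ≤ 1 + ‖y‖ * (1 / √v) := by
      rw [Prod.norm_mk, norm_neg, norm_smul, norm_one, Real.norm_of_nonneg (by positivity)]
      refine max_le ?_ (by have : 0 ≤ ‖y‖ * (1 / √v) := by positivity
                           linarith)
      have : 1 / (2 * √v) ≤ 1 / √v := by
        apply one_div_le_one_div_of_le hs; linarith
      nlinarith [norm_nonneg y]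
    have h2 : ‖fderiv ℝ ψ q (-((1 / (2 * √v)) • y), 1)‖ ≤ C * (1 + ‖y‖ * (1 / √v)) :=
      (ContinuousLinearMap.le_opNorm _ _).trans
        (mul_le_mul (hd q) h1 (norm_nonneg _) hC0)
    calc _ ≤ heatKernel n 1 y * (C * (1 + ‖y‖ * (1 / √v))) :=
          mul_le_mul_of_nonneg_left h2 (heatKernel_nonneg zero_le_one y)
      _ = _ := by ring
  have key : ∀ (p : SpaceTime n) (v : ℝ), 0 < v → HasDerivAt (fun v => heatAvg ψ v p)
      (∫ y, heatKernel n 1 y *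
        fderiv ℝ ψ (p.1 - √v • y, p.2 + v) (-((1 / (2 * √v)) • y), 1)) v := by
    intro p v hv
    -- On the ball of radius `v / 2` about `v` the singular factor stays below `1 / √(v / 2)`.
    have hv2 : 0 < v / 2 := by positivity
    refine (hasDerivAt_integral_of_dominated_loc_of_deriv_le
      (bound := fun y => C * (heatKernel n 1 y + (heatKernel n 1 y * ‖y‖) * (1 / √(v / 2))))
      (F := fun w y => heatKernel n 1 y * ψ (p.1 - √w • y, p.2 + w))
      (F' := fun w y => heatKernel n 1 y *
        fderiv ℝ ψ (p.1 - √w • y, p.2 + w) (-((1 / (2 * √w)) • y), 1))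
      (Metric.ball_mem_nhds v hv2) ?_ ?_ ?_ ?_ ?_ ?_).2
    · refine Eventually.of_forall fun w => ?_
      exact ((continuous_heatKernel 1).mul (hψ.continuous.comp (by fun_prop))).aestronglyMeasurable
    · refine (hG.mul_const C).mono' ?_ (Eventually.of_forall fun y =>
        norm_heatKernel_mul_le hb zero_le_one _ _)
      exact ((continuous_heatKernel 1).mul (hψ.continuous.comp (by fun_prop))).aestronglyMeasurable
    · refine Continuous.aestronglyMeasurable ((continuous_heatKernel 1).mul ?_)
      exact ((hψ.continuous_fderiv (by norm_num)).comp (by fun_prop)).clm_apply (by fun_prop)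
    · refine Eventually.of_forall fun y w hw => ?_
      have hw' : v / 2 < w := by
        rw [Metric.mem_ball, Real.dist_eq, abs_lt] at hw; linarith [hw.1]
      refine (hbound w (hv2.trans hw') y _).trans ?_
      have := heatKernel_nonneg zero_le_one y
      have h3 : 0 < √(v / 2) := Real.sqrt_pos.2 hv2
      gcongr
    · exact (hG.add (hG1.mul_const _)).const_mul C
    · refine Eventually.of_forall fun y w hw => ?_
      have hw' : 0 < w := by
        rw [Metric.mem_ball, Real.dist_eq, abs_lt] at hw; linarith [hw.1]
      have h1 : HasDerivAt (fun w => ((p.1 - √w • y, p.2 + w) : SpaceTime n))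
          (-((1 / (2 * √w)) • y), 1) w := by
        refine HasDerivAt.prodMk ?_ ((hasDerivAt_id w).const_add _)
        exact ((Real.hasDerivAt_sqrt hw'.ne').smul_const y).const_sub _
      exact ((hdiff _).hasFDerivAt.comp_hasDerivAt w h1).const_mul _
  refine ⟨C * (1 + M), by positivity, fun p v hv => ⟨(key p v hv).differentiableAt, ?_⟩⟩
  rw [(key p v hv).deriv]
  have h := norm_integral_le_of_norm_le ((hG.add (hG1.mul_const (1 / √v))).const_mul C)
    (Eventually.of_forall fun y => hbound v hv y (p.1 - √v • y, p.2 + v))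
  refine h.trans ?_
  simp only [Pi.add_apply]
  rw [integral_const_mul, integral_add hG (hG1.mul_const _), integral_mul_const,
    integral_heatKernel zero_lt_one]
  have hs : 0 < 1 / √v := by have := Real.sqrt_pos.2 hv; positivity
  nlinarith [mul_nonneg hC0 hs.le, mul_nonneg hC0 hM]

/-! ### The cutoff and its Beta averages. -/

/-- A smooth function equal to `1` on `(-∞, 1]` and to `0` on `[2, ∞)`. -/
def cutoff (r : ℝ) : ℝ := Real.smoothTransition (2 - r)

lemma contDiff_cutoff : ContDiff ℝ ∞ cutoff :=
  Real.smoothTransition.contDiff.comp (contDiff_const.sub contDiff_id)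

lemma cutoff_of_le_one {r : ℝ} (h : r ≤ 1) : cutoff r = 1 :=
  Real.smoothTransition.one_of_one_le (by linarith)

lemma cutoff_of_two_le {r : ℝ} (h : 2 ≤ r) : cutoff r = 0 :=
  Real.smoothTransition.zero_of_nonpos (by linarith)

lemma cutoff_nonneg (r : ℝ) : 0 ≤ cutoff r := Real.smoothTransition.nonneg _

lemma cutoff_le_one (r : ℝ) : cutoff r ≤ 1 := Real.smoothTransition.le_one _

lemma deriv_eq_zero_off_Icc {g : ℝ → ℝ} {a b c d : ℝ} (h1 : ∀ r < a, g r = c)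
    (h2 : ∀ r > b, g r = d) : (∀ r < a, deriv g r = 0) ∧ ∀ r > b, deriv g r = 0 := by
  constructor
  · intro r hr
    have : g =ᶠ[𝓝 r] fun _ => c := by
      filter_upwards [Iio_mem_nhds hr] with x hx using h1 x hx
    rw [this.deriv_eq, deriv_const]
  · intro r hr
    have : g =ᶠ[𝓝 r] fun _ => d := by
      filter_upwards [Ioi_mem_nhds hr] with x hx using h2 x hx
    rw [this.deriv_eq, deriv_const]

lemma exists_abs_le_of_zero_off_Icc {g : ℝ → ℝ} (hc : Continuous g) {a b : ℝ}
    (h1 : ∀ r < a, g r = 0) (h2 : ∀ r > b, g r = 0) : ∃ A : ℝ, 0 ≤ A ∧ ∀ r, |g r| ≤ A := by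
  obtain ⟨A, hA⟩ := (isCompact_Icc (a := a) (b := b)).exists_bound_of_continuousOn hc.continuousOn
  refine ⟨max A 0, le_max_right _ _, fun r => ?_⟩
  by_cases ha : r < a
  · simp [h1 r ha]
  by_cases hb : r > b
  · simp [h2 r hb]
  exact (hA r ⟨not_lt.1 ha, not_lt.1 hb⟩).trans (le_max_left _ _)

/-- The density of the Beta distribution of parameters `s` and `1 - s`, up to a factor. -/
def betaWeight (s r : ℝ) : ℝ := r ^ (s - 1) * (1 - r) ^ (-s)

lemma betaWeight_pos {s r : ℝ} (hr : r ∈ Ioo (0 : ℝ) 1) : 0 < betaWeight s r :=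
  mul_pos (Real.rpow_pos_of_pos hr.1 _) (Real.rpow_pos_of_pos (by linarith [hr.2]) _)

lemma measurable_betaWeight (s : ℝ) : Measurable (betaWeight s) := by
  unfold betaWeight; fun_prop

lemma integrableOn_betaWeight {s : ℝ} (hs0 : 0 < s) (hs1 : s < 1) :
    IntegrableOn (betaWeight s) (Ioo 0 1) := by
  have h := (Complex.betaIntegral_convergent (u := (s : ℂ)) (v := ((1 - s : ℝ) : ℂ))
    (by simpa) (by simpa)).norm
  rw [intervalIntegrable_iff_integrableOn_Ioo_of_le zero_le_one] at h
  refine h.congr_fun (fun r hr => ?_) measurableSet_Ioo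
  have h1 : (1 : ℂ) - r = ((1 - r : ℝ) : ℂ) := by push_cast; ring
  simp only [norm_mul, betaWeight]
  rw [h1, Complex.norm_cpow_eq_rpow_re_of_pos hr.1,
    Complex.norm_cpow_eq_rpow_re_of_pos (by linarith [hr.2])]
  simp

/-- The averages `∫₀¹ g(vr) rʲ r^(s-1) (1-r)^(-s) dr`. -/
def betaAvg (s : ℝ) (g : ℝ → ℝ) (j : ℕ) (v : ℝ) : ℝ :=
  ∫ r in Ioo (0 : ℝ) 1, g (v * r) * (r ^ j * betaWeight s r)

lemma pow_mul_betaWeight_le {s r : ℝ} (hr : r ∈ Ioo (0 : ℝ) 1) (j : ℕ) :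
    |r ^ j * betaWeight s r| ≤ betaWeight s r := by
  have h := betaWeight_pos (s := s) hr
  rw [abs_of_nonneg (mul_nonneg (pow_nonneg hr.1.le _) h.le)]
  exact mul_le_of_le_one_left h.le (pow_le_one₀ hr.1.le hr.2.le)

lemma integrableOn_betaAvg {s : ℝ} (hs0 : 0 < s) (hs1 : s < 1) {g : ℝ → ℝ} (hc : Continuous g)
    {A : ℝ} (hA : ∀ r, |g r| ≤ A) (j : ℕ) (v : ℝ) :
    IntegrableOn (fun r => g (v * r) * (r ^ j * betaWeight s r)) (Ioo 0 1) := by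
  refine ((integrableOn_betaWeight hs0 hs1).const_mul A).mono' ?_ ?_
  · have := measurable_betaWeight s
    have := hc.measurable
    exact Measurable.aestronglyMeasurable (by fun_prop)
  · refine (ae_restrict_iff' measurableSet_Ioo).2 (Eventually.of_forall fun r hr => ?_)
    rw [norm_mul]
    exact mul_le_mul (hA _) (pow_mul_betaWeight_le hr j) (norm_nonneg _)
      ((abs_nonneg _).trans (hA 0))

/-- Each derivative in `v` brings down a factor `r`; the index `j` records it. These powers later
supply the decay. -/
lemma hasDerivAt_betaAvg {s : ℝ} (hs0 : 0 < s) (hs1 : s < 1) {g : ℝ → ℝ} (hg : ContDiff ℝ 1 g)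
    {A : ℝ} (hA : ∀ r, |g r| ≤ A) (hA' : ∀ r, |deriv g r| ≤ A) (j : ℕ) (v : ℝ) :
    HasDerivAt (betaAvg s g j) (betaAvg s (deriv g) (j + 1) v) v := by
  have hg' : Continuous (deriv g) := hg.continuous_deriv (by norm_num)
  have hd : Differentiable ℝ g := hg.differentiable (by norm_num)
  refine (hasDerivAt_integral_of_dominated_loc_of_deriv_le
      (bound := fun r => A * betaWeight s r)
      (F := fun v r => g (v * r) * (r ^ j * betaWeight s r))
      (F' := fun v r => deriv g (v * r) * (r ^ (j + 1) * betaWeight s r))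
      (Metric.ball_mem_nhds v one_pos) ?_ ?_ ?_ ?_ ?_ ?_).2
  · exact Eventually.of_forall fun w => (integrableOn_betaAvg hs0 hs1 hg.continuous hA j w).1
  · exact integrableOn_betaAvg hs0 hs1 hg.continuous hA j v
  · exact (integrableOn_betaAvg hs0 hs1 hg' hA' (j + 1) v).1
  · refine (ae_restrict_iff' measurableSet_Ioo).2 (Eventually.of_forall fun r hr w _ => ?_)
    rw [norm_mul]
    exact mul_le_mul (hA' _) (pow_mul_betaWeight_le hr _) (norm_nonneg _)
      ((abs_nonneg _).trans (hA 0))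
  · exact (integrableOn_betaWeight hs0 hs1).const_mul A
  · refine (ae_restrict_iff' measurableSet_Ioo).2 (Eventually.of_forall fun r hr w _ => ?_)
    have h := ((hd (w * r)).hasDerivAt.comp w ((hasDerivAt_id w).mul_const r)).mul_const
      (r ^ j * betaWeight s r)
    refine h.congr_deriv ?_
    ring

lemma betaAvg_eq_zero {s : ℝ} {g : ℝ → ℝ} (h1 : ∀ r < 1, g r = 0) (j : ℕ) {v : ℝ} (hv : v ≤ 1) :
    betaAvg s g j v = 0 := by
  refine setIntegral_eq_zero_of_forall_eq_zero fun r hr => ?_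
  rw [h1 _ (by nlinarith [hr.1, hr.2]), zero_mul]

/-- Only `r` between `1/v` and `2/v` contributes, an interval of length `1/v`. At least one factor
`r` is present, so the integrand there is of size `r^s`, that is `v^(-s)`. For bounded `v` the
trivial bound suffices. -/
lemma exists_abs_betaAvg_le {s : ℝ} (hs0 : 0 < s) (hs1 : s < 1) {g : ℝ → ℝ} (hc : Continuous g)
    (h1 : ∀ r < 1, g r = 0) (h2 : ∀ r > 2, g r = 0) (j : ℕ) :
    ∃ C : ℝ, 0 ≤ C ∧ ∀ v : ℝ, 0 < v → |betaAvg s g (j + 1) v| ≤ C * v ^ (-1 - s) := by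
  obtain ⟨A, hA0, hA⟩ := exists_abs_le_of_zero_off_Icc hc h1 h2
  set B := ∫ r in Ioo (0 : ℝ) 1, betaWeight s r
  have hB : 0 ≤ B := setIntegral_nonneg measurableSet_Ioo fun r hr => (betaWeight_pos hr).le
  have h4s : (0 : ℝ) < 4 ^ s := by positivity
  have h4s' : (0 : ℝ) < 4 ^ (1 + s) := by positivity
  refine ⟨A * B * 4 ^ (1 + s) + A * 4 ^ s, by positivity, fun v hv => ?_⟩
  have hvp : 0 < v ^ (-1 - s) := Real.rpow_pos_of_pos hv _
  -- For `v ≥ 4` the relevant `r ≤ 2/v` stay below `1/2`, away from the singularity of `(1 -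
  -- r)^(-s)`.
  rcases le_total v 4 with h4 | h4
  · have hle : |betaAvg s g (j + 1) v| ≤ A * B := by
      have := norm_integral_le_of_norm_le ((integrableOn_betaWeight hs0 hs1).const_mul A)
        (f := fun r => g (v * r) * (r ^ (j + 1) * betaWeight s r))
        ((ae_restrict_iff' measurableSet_Ioo).2 (Eventually.of_forall fun r hr => by
          rw [norm_mul]
          exact mul_le_mul (hA _) (pow_mul_betaWeight_le hr _) (norm_nonneg _) hA0))
      rwa [integral_const_mul] at this
    have h5 : 1 ≤ 4 ^ (1 + s) * v ^ (-1 - s) := by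
      rw [show -1 - s = -(1 + s) by ring, Real.rpow_neg hv.le, ← div_eq_mul_inv,
        one_le_div (by positivity)]
      exact Real.rpow_le_rpow hv.le h4 (by linarith)
    calc _ ≤ A * B * 1 := by linarith
      _ ≤ A * B * (4 ^ (1 + s) * v ^ (-1 - s)) := by gcongr
      _ ≤ _ := by
        rw [add_mul, ← mul_assoc]
        have : 0 ≤ A * 4 ^ s * v ^ (-1 - s) := by positivity
        linarith
  -- The vanishing of `g` is assumed only strictly outside `[1, 2]`; the endpoint `r = 1/v`, missing
  -- from the half-open interval, is a null set.
  · have hbd : ∀ r ∈ Ioo (0 : ℝ) 1, ‖g (v * r) * (r ^ (j + 1) * betaWeight s r)‖ ≤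
        (Ioc (1 / v) (2 / v)).indicator (fun _ => A * (4 ^ s * v ^ (-s))) r ∨ r = 1 / v := by
      intro r hr
      by_cases hr1 : r = 1 / v
      · exact Or.inr hr1
      left
      by_cases hm : r ∈ Ioc (1 / v) (2 / v)
      · rw [indicator_of_mem hm, norm_mul]
        have hr2 : r ≤ 1 / 2 := hm.2.trans (by rw [div_le_div_iff₀ hv two_pos]; linarith)
        refine mul_le_mul (hA _) ?_ (norm_nonneg _) hA0
        have h0 := betaWeight_pos (s := s) hr
        rw [Real.norm_of_nonneg (mul_nonneg (pow_nonneg hr.1.le _) h0.le)]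
        have e1 : r ^ (j + 1) * betaWeight s r ≤ r * betaWeight s r := by
          refine mul_le_mul_of_nonneg_right ?_ h0.le
          exact pow_le_of_le_one hr.1.le hr.2.le (by omega)
        have e2 : r * betaWeight s r = r ^ s * (1 - r) ^ (-s) := by
          unfold betaWeight
          rw [← mul_assoc]
          congr 1
          nth_rewrite 1 [← Real.rpow_one r]
          rw [← Real.rpow_add hr.1]
          congr 1; ring
        have e3 : r ^ s ≤ (2 / v) ^ s := Real.rpow_le_rpow hr.1.le hm.2 hs0.le
        have e4 : (1 - r) ^ (-s) ≤ 2 ^ s := by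
          rw [Real.rpow_neg (by linarith), ← Real.inv_rpow (by linarith)]
          refine Real.rpow_le_rpow (inv_nonneg.2 (by linarith)) ?_ hs0.le
          rw [inv_le_comm₀ (by linarith) two_pos]; linarith
        calc _ ≤ r ^ s * (1 - r) ^ (-s) := e1.trans_eq e2
          _ ≤ (2 / v) ^ s * 2 ^ s :=
            mul_le_mul e3 e4 (Real.rpow_nonneg (by linarith) _) (by positivity)
          _ = 4 ^ s * v ^ (-s) := by
            rw [Real.div_rpow two_pos.le hv.le, Real.rpow_neg hv.le,
              show (4 : ℝ) = 2 * 2 by norm_num, Real.mul_rpow two_pos.le two_pos.le]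
            ring
      · rw [indicator_of_notMem hm]
        have : g (v * r) = 0 := by
          rw [mem_Ioc, not_and_or, not_lt, not_le] at hm
          rcases hm with h | h
          · refine h1 _ ?_
            have := lt_of_le_of_ne h hr1
            rw [lt_div_iff₀ hv] at this; linarith
          · refine h2 _ ?_
            rw [div_lt_iff₀ hv] at h; linarith
        simp [this]
    have hne : ∀ᵐ r : ℝ, r ≠ 1 / v := by
      simp [ae_iff, measure_singleton]
    have hint : Integrable ((Ioc (1 / v) (2 / v)).indicator
        (fun _ => A * (4 ^ s * v ^ (-s)))) :=
      (integrable_indicator_iff measurableSet_Ioc).2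
        (integrableOn_const (by simp) enorm_ne_top)
    have h6 := norm_integral_le_of_norm_le (hint.integrableOn (s := Ioo 0 1))
        (f := fun r => g (v * r) * (r ^ (j + 1) * betaWeight s r))
        ((ae_restrict_iff' measurableSet_Ioo).2 (by
          filter_upwards [hne] with r hr hr'
          exact (hbd r hr').resolve_right hr))
    have h7 : ∫ r in Ioo (0 : ℝ) 1, (Ioc (1 / v) (2 / v)).indicator
        (fun _ => A * (4 ^ s * v ^ (-s))) r ≤ ∫ r, (Ioc (1 / v) (2 / v)).indicator
        (fun _ => A * (4 ^ s * v ^ (-s))) r :=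
      setIntegral_le_integral hint (Eventually.of_forall fun r =>
        indicator_nonneg (fun _ _ => by positivity) r)
    have h8 : ∫ r, (Ioc (1 / v) (2 / v)).indicator (fun _ => A * (4 ^ s * v ^ (-s))) r =
        A * 4 ^ s * v ^ (-1 - s) := by
      rw [integral_indicator measurableSet_Ioc, setIntegral_const, Real.volume_real_Ioc_of_le
        (by gcongr; norm_num), smul_eq_mul, show -1 - s = -s + -1 by ring, Real.rpow_add hv,
        Real.rpow_neg_one]
      field_simp; ring
    calc _ ≤ A * 4 ^ s * v ^ (-1 - s) := h6.trans (h7.trans_eq h8)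
      _ ≤ _ := by
        rw [add_mul]
        have : 0 ≤ A * B * 4 ^ (1 + s) * v ^ (-1 - s) := by positivity
        linarith

/-- The Riemann-Liouville integral of order `1 - s` of `σ^(s-1) χ(σ)`. -/
def profile (s : ℝ) : ℝ → ℝ := betaAvg s cutoff 0

/-- The derivative of `profile`. -/
def profile' (s : ℝ) : ℝ → ℝ := betaAvg s (deriv cutoff) 1

/-- The second derivative of `profile`. -/
def profile'' (s : ℝ) : ℝ → ℝ := betaAvg s (deriv (deriv cutoff)) 2

lemma abs_cutoff_le (r : ℝ) : |cutoff r| ≤ 1 := by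
  rw [abs_of_nonneg (cutoff_nonneg r)]; exact cutoff_le_one r

lemma contDiff_deriv_cutoff : ContDiff ℝ ∞ (deriv cutoff) :=
  (contDiff_infty_iff_deriv.1 contDiff_cutoff).2

lemma deriv_cutoff_zero : (∀ r < 1, deriv cutoff r = 0) ∧ ∀ r > 2, deriv cutoff r = 0 :=
  deriv_eq_zero_off_Icc (fun _ h => cutoff_of_le_one h.le) fun _ h => cutoff_of_two_le h.le

lemma deriv_deriv_cutoff_zero :
    (∀ r < 1, deriv (deriv cutoff) r = 0) ∧ ∀ r > 2, deriv (deriv cutoff) r = 0 :=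
  deriv_eq_zero_off_Icc deriv_cutoff_zero.1 deriv_cutoff_zero.2

lemma continuous_deriv_deriv_cutoff : Continuous (deriv (deriv cutoff)) :=
  (contDiff_infty_iff_deriv.1 contDiff_deriv_cutoff).2.continuous

lemma hasDerivAt_profile {s : ℝ} (hs0 : 0 < s) (hs1 : s < 1) (v : ℝ) :
    HasDerivAt (profile s) (profile' s v) v := by
  obtain ⟨A, hA0, hA⟩ := exists_abs_le_of_zero_off_Icc contDiff_deriv_cutoff.continuous
    deriv_cutoff_zero.1 deriv_cutoff_zero.2
  exact hasDerivAt_betaAvg hs0 hs1 (contDiff_cutoff.of_le (by exact_mod_cast le_top))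
    (fun r => (abs_cutoff_le r).trans (le_max_right A 1))
    (fun r => (hA r).trans (le_max_left A 1)) 0 v

lemma hasDerivAt_profile' {s : ℝ} (hs0 : 0 < s) (hs1 : s < 1) (v : ℝ) :
    HasDerivAt (profile' s) (profile'' s v) v := by
  obtain ⟨A, hA0, hA⟩ := exists_abs_le_of_zero_off_Icc contDiff_deriv_cutoff.continuous
    deriv_cutoff_zero.1 deriv_cutoff_zero.2
  obtain ⟨B, hB0, hB⟩ := exists_abs_le_of_zero_off_Icc continuous_deriv_deriv_cutoff
    deriv_deriv_cutoff_zero.1 deriv_deriv_cutoff_zero.2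
  exact hasDerivAt_betaAvg hs0 hs1 (contDiff_deriv_cutoff.of_le (by exact_mod_cast le_top))
    (fun r => (hA r).trans (le_max_left A B))
    (fun r => (hB r).trans (le_max_right A B)) 1 v

/-- For `v ≤ 1` the cutoff is not felt and the Abel integral is the constant `B(s, 1 - s)`. Hence
the error term only sees times beyond `T`. -/
lemma profile'_eq_zero {s v : ℝ} (hv : v ≤ 1) : profile' s v = 0 :=
  betaAvg_eq_zero deriv_cutoff_zero.1 1 hv

lemma profile''_eq_zero {s v : ℝ} (hv : v ≤ 1) : profile'' s v = 0 :=
  betaAvg_eq_zero deriv_deriv_cutoff_zero.1 2 hv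

lemma exists_abs_profile'_le {s : ℝ} (hs0 : 0 < s) (hs1 : s < 1) :
    ∃ C : ℝ, 0 ≤ C ∧ ∀ v : ℝ, 0 < v →
      |profile' s v| ≤ C * v ^ (-1 - s) ∧ |profile'' s v| ≤ C * v ^ (-1 - s) := by
  obtain ⟨A, hA0, hA⟩ := exists_abs_betaAvg_le hs0 hs1 contDiff_deriv_cutoff.continuous
    deriv_cutoff_zero.1 deriv_cutoff_zero.2 0
  obtain ⟨B, hB0, hB⟩ := exists_abs_betaAvg_le hs0 hs1 continuous_deriv_deriv_cutoff
    deriv_deriv_cutoff_zero.1 deriv_deriv_cutoff_zero.2 1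
  refine ⟨max A B, hA0.trans (le_max_left _ _), fun v hv => ?_⟩
  have := Real.rpow_nonneg hv.le (-1 - s)
  exact ⟨(hA v hv).trans (mul_le_mul_of_nonneg_right (le_max_left _ _) this),
    (hB v hv).trans (mul_le_mul_of_nonneg_right (le_max_right _ _) this)⟩

lemma profile_zero_pos {s : ℝ} (hs0 : 0 < s) (hs1 : s < 1) : 0 < profile s 0 := by
  have e : profile s 0 = ∫ r in Ioo (0 : ℝ) 1, betaWeight s r := by
    simp [profile, betaAvg, cutoff_of_le_one]
  rw [e]
  rw [setIntegral_pos_iff_support_of_nonneg_ae ((ae_restrict_iff' measurableSet_Ioo).2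
    (Eventually.of_forall fun r hr => (betaWeight_pos hr).le)) (integrableOn_betaWeight hs0 hs1)]
  refine lt_of_lt_of_le ?_ (measure_mono (s := Ioo (0 : ℝ) 1)
    fun r hr => ⟨(betaWeight_pos hr).ne', hr⟩)
  simp

lemma abs_profile_le {s : ℝ} (hs0 : 0 < s) (hs1 : s < 1) (v : ℝ) :
    |profile s v| ≤ profile s 0 := by
  have e : profile s 0 = ∫ r in Ioo (0 : ℝ) 1, betaWeight s r := by
    simp [profile, betaAvg, cutoff_of_le_one]
  rw [e]
  refine norm_integral_le_of_norm_le (f := fun r => cutoff (v * r) * (r ^ 0 * betaWeight s r))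
    (integrableOn_betaWeight hs0 hs1)
    ((ae_restrict_iff' measurableSet_Ioo).2 (Eventually.of_forall fun r hr => ?_))
  rw [norm_mul]
  exact (mul_le_mul (abs_cutoff_le _) (pow_mul_betaWeight_le hr 0) (abs_nonneg _)
    zero_le_one).trans_eq (one_mul _)

/-! ### The truncated power and its Abel integral. -/

/-- The kernel `σ^(s-1) χ(σ/T)`. -/
def truncPow (s T σ : ℝ) : ℝ := σ ^ (s - 1) * cutoff (σ / T)

lemma truncPow_nonneg {s T σ : ℝ} (hσ : 0 ≤ σ) : 0 ≤ truncPow s T σ :=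
  mul_nonneg (Real.rpow_nonneg hσ _) (cutoff_nonneg _)

lemma measurable_truncPow (s T : ℝ) : Measurable (truncPow s T) := by
  have : Measurable cutoff := contDiff_cutoff.continuous.measurable
  unfold truncPow
  fun_prop

lemma truncPow_eq_zero {s T σ : ℝ} (hT : 0 < T) (h : 2 * T ≤ σ) : truncPow s T σ = 0 := by
  rw [truncPow, cutoff_of_two_le, mul_zero]
  rwa [le_div_iff₀ hT]

lemma integrableOn_truncPow {s T : ℝ} (hs0 : 0 < s) (hT : 0 < T) :
    IntegrableOn (truncPow s T) (Ioi 0) := by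
  have h1 : IntegrableOn (fun σ : ℝ => σ ^ (s - 1)) (Ioc 0 (2 * T)) := by
    rw [← intervalIntegrable_iff_integrableOn_Ioc_of_le (by positivity)]
    exact intervalIntegral.intervalIntegrable_rpow' (by linarith)
  rw [← Ioc_union_Ioi_eq_Ioi (show (0 : ℝ) ≤ 2 * T by positivity)]
  refine IntegrableOn.union ?_ ?_
  · refine h1.mono' (measurable_truncPow s T).aestronglyMeasurable ?_
    refine (ae_restrict_iff' measurableSet_Ioc).2 (Eventually.of_forall fun σ hσ => ?_)
    rw [Real.norm_of_nonneg (truncPow_nonneg hσ.1.le)]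
    exact mul_le_of_le_one_right (Real.rpow_nonneg hσ.1.le _) (cutoff_le_one _)
  · refine (integrableOn_zero).congr_fun (fun σ hσ => ?_) measurableSet_Ioi
    exact (truncPow_eq_zero hT (le_of_lt hσ)).symm

/-- The Abel integral of the truncated power. -/
lemma integrableOn_truncPow_mul {s T v : ℝ} (hs0 : 0 < s) (hs1 : s < 1) (hv : 0 < v) :
    IntegrableOn (fun σ => truncPow s T σ * (v - σ) ^ (-s)) (Ioo 0 v) ∧
      ∫ σ in Ioo 0 v, truncPow s T σ * (v - σ) ^ (-s) = profile s (v / T) := by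
  have e : ∀ r ∈ Ioo (0 : ℝ) 1, v * (truncPow s T (v * r) * (v - v * r) ^ (-s)) =
      cutoff (v / T * r) * (r ^ 0 * betaWeight s r) := by
    intro r hr
    have h1 : (0 : ℝ) < 1 - r := by linarith [hr.2]
    unfold truncPow betaWeight
    rw [show v - v * r = v * (1 - r) by ring, Real.mul_rpow hv.le hr.1.le,
      Real.mul_rpow hv.le h1.le, show v * r / T = v / T * r by ring, pow_zero, one_mul]
    have : v * v ^ (s - 1) * v ^ (-s) = 1 := by
      nth_rewrite 1 [← Real.rpow_one v]
      rw [← Real.rpow_add hv, ← Real.rpow_add hv]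
      simp
    calc _ = (v * v ^ (s - 1) * v ^ (-s)) * (cutoff (v / T * r) *
          (r ^ (s - 1) * (1 - r) ^ (-s))) := by ring
      _ = _ := by rw [this, one_mul]
  have him : (fun r => v * r) '' Ioo (0 : ℝ) 1 = Ioo 0 v := by
    rw [image_mul_left_Ioo hv]; simp
  have hd : ∀ r ∈ Ioo (0 : ℝ) 1, HasDerivWithinAt (fun r => v * r) v (Ioo 0 1) r := fun r _ => by
    simpa using ((hasDerivAt_id r).const_mul v).hasDerivWithinAt
  have hinj : InjOn (fun r => v * r) (Ioo (0 : ℝ) 1) := fun a _ b _ h =>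
    mul_left_cancel₀ hv.ne' h
  have e' : ∀ r ∈ Ioo (0 : ℝ) 1, |v| • (truncPow s T (v * r) * (v - v * r) ^ (-s)) =
      cutoff (v / T * r) * (r ^ 0 * betaWeight s r) := fun r hr => by
    rw [abs_of_pos hv, smul_eq_mul, e r hr]
  constructor
  · rw [← him, integrableOn_image_iff_integrableOn_abs_deriv_smul measurableSet_Ioo hd hinj]
    exact (integrableOn_betaAvg hs0 hs1 contDiff_cutoff.continuous abs_cutoff_le 0
      (v / T)).congr_fun (fun r hr => (e' r hr).symm) measurableSet_Ioo
  · rw [← him, integral_image_eq_integral_abs_deriv_smul measurableSet_Ioo hd hinj]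
    exact setIntegral_congr_fun measurableSet_Ioo e'

lemma integrableOn_one_add_inv_sqrt (M : ℝ) :
    IntegrableOn (fun v : ℝ => 1 + 1 / √v) (Ioc 0 M) := by
  refine (integrableOn_const (by simp) (by simp)).add ?_
  rcases le_total M 0 with h | h
  · simp [Ioc_eq_empty_of_le h]
  have h1 : IntegrableOn (fun σ : ℝ => σ ^ (-(1 / 2) : ℝ)) (Ioc 0 M) := by
    rw [← intervalIntegrable_iff_integrableOn_Ioc_of_le h]
    exact intervalIntegral.intervalIntegrable_rpow' (by norm_num)
  refine h1.congr_fun (fun v hv => ?_) measurableSet_Ioc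
  simp only
  rw [Real.rpow_neg hv.1.le, Real.sqrt_eq_rpow, one_div, one_div]

lemma integral_rpow_indicator {s a : ℝ} (hs0 : 0 < s) (ha : 0 < a) :
    IntegrableOn (fun τ : ℝ => τ ^ (-1 - s) * (Ici a).indicator 1 τ) (Ioi 0) ∧
    ∫ τ in Ioi (0 : ℝ), τ ^ (-1 - s) * (Ici a).indicator 1 τ = a ^ (-s) / s := by
  have e : (fun τ : ℝ => τ ^ (-1 - s) * (Ici a).indicator 1 τ) =
      (Ici a).indicator fun τ => τ ^ (-1 - s) := by
    funext τ
    by_cases h : τ ∈ Ici a <;> simp [h]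
  have hsub : Ici a ⊆ Ioi (0 : ℝ) := fun x hx => lt_of_lt_of_le ha hx
  rw [e]
  constructor
  · refine Integrable.integrableOn ((integrable_indicator_iff measurableSet_Ici).2 ?_)
    rw [integrableOn_Ici_iff_integrableOn_Ioi]
    exact integrableOn_Ioi_rpow_of_lt (by linarith) ha
  · rw [setIntegral_indicator measurableSet_Ici, inter_eq_right.2 hsub,
      integral_Ici_eq_integral_Ioi, integral_Ioi_rpow_of_lt (by linarith) ha]
    rw [show -1 - s + 1 = -s by ring, neg_div_neg_eq]

/-! ### The Marchaud derivative along the semigroup. -/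

section Marchaud

variable {F : ℝ → ℝ} {C M : ℝ}

lemma integrableOn_deriv_of_le (hM : ∀ v, M < v → F v = 0)
    (hb : ∀ v, 0 < v → |deriv F v| ≤ C * (1 + 1 / √v)) :
    IntegrableOn (deriv F) (Ioi 0) := by
  have hz : ∀ v ∈ Ioi (max M 0), deriv F v = 0 := by
    intro v hv
    have : F =ᶠ[𝓝 v] fun _ => 0 := by
      filter_upwards [Ioi_mem_nhds (lt_of_le_of_lt (le_max_left _ _) hv)] with x hx using hM x hx
    rw [this.deriv_eq, deriv_const]
  rw [← Ioc_union_Ioi_eq_Ioi (le_max_right M 0)]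
  refine IntegrableOn.union ?_ ?_
  · refine ((integrableOn_one_add_inv_sqrt (max M 0)).const_mul C).mono'
      (measurable_deriv F).aestronglyMeasurable ?_
    exact (ae_restrict_iff' measurableSet_Ioc).2 (Eventually.of_forall fun σ hσ => hb σ hσ.1)
  · exact integrableOn_zero.congr_fun (fun v hv => (hz v hv).symm) measurableSet_Ioi

lemma integral_deriv_indicator (hd : ∀ v, 0 < v → DifferentiableAt ℝ F v)
    (hi : IntegrableOn (deriv F) (Ioi 0)) {σ τ : ℝ} (hσ : 0 < σ) (hτ : 0 < τ) :
    ∫ v in Ioi 0, (Ioc σ (σ + τ)).indicator (deriv F) v = F (σ + τ) - F σ := by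
  have hsub : Ioc σ (σ + τ) ⊆ Ioi 0 := fun v hv => hσ.trans hv.1
  have hle : σ ≤ σ + τ := by linarith
  rw [setIntegral_indicator measurableSet_Ioc, inter_eq_right.2 hsub,
    ← intervalIntegral.integral_of_le hle]
  refine intervalIntegral.integral_deriv_eq_sub (fun v hv => hd v ?_) ?_
  · rw [uIcc_of_le hle] at hv
    exact hσ.trans_le hv.1
  · rw [intervalIntegrable_iff_integrableOn_Ioc_of_le hle]
    exact hi.mono_set hsub

/-- The Marchaud derivative of order `s`, integrated against the truncated power. -/
lemma integral_marchaud {s T : ℝ} (hs0 : 0 < s) (hs1 : s < 1)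
    (hd : ∀ v, 0 < v → DifferentiableAt ℝ F v) (hi : IntegrableOn (deriv F) (Ioi 0)) :
    ∫ τ in Ioi (0 : ℝ), τ ^ (-1 - s) * ∫ σ in Ioi (0 : ℝ),
      truncPow s T σ * (F σ - F (σ + τ)) =
    -(1 / s) * ∫ v in Ioi (0 : ℝ), deriv F v * profile s (v / T) := by
  set μ : Measure ℝ := volume.restrict (Ioi 0)
  have hμ : ∀ᵐ x ∂μ, 0 < x := ae_restrict_mem measurableSet_Ioi
  -- Writing `F (σ + τ) - F σ` as the integral of `deriv F` over `(σ, σ + τ]` turns the left side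
  -- into minus a triple integral of `Ψ`. Integrating first over `τ ≥ v - σ` yields `(v - σ)^(-s) /
  -- s`; the integral in `σ` is then the Abel integral.
  let Ψ : (ℝ × ℝ) × ℝ → ℝ := fun q => q.2 ^ (-1 - s) *
    (truncPow s T q.1.2 * {q : (ℝ × ℝ) × ℝ | q.1.2 < q.1.1 ∧ q.1.1 ≤ q.1.2 + q.2}.indicator 1 q *
      deriv F q.1.1)
  have hmeas : Measurable Ψ := by
    have h1 := measurable_deriv F
    have h2 := measurable_truncPow s T
    have h3 : Measurable ({q : (ℝ × ℝ) × ℝ | q.1.2 < q.1.1 ∧ q.1.1 ≤ q.1.2 + q.2}.indicator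
        (1 : (ℝ × ℝ) × ℝ → ℝ)) := by
      refine measurable_one.indicator (MeasurableSet.inter ?_ ?_)
      · exact measurableSet_lt measurable_fst.snd measurable_fst.fst
      · exact measurableSet_le measurable_fst.fst (measurable_fst.snd.add measurable_snd)
    fun_prop
  have hslice : ∀ v σ τ, Ψ ((v, σ), τ) = (truncPow s T σ * (Ioi σ).indicator 1 v * deriv F v) *
      (τ ^ (-1 - s) * (Ici (v - σ)).indicator 1 τ) := by
    intro v σ τ
    by_cases h1 : σ < v <;> by_cases h2 : v ≤ σ + τ
    all_goals
      have h2' : v - σ ≤ τ ↔ v ≤ σ + τ := by constructor <;> intro h <;> linarith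
      simp [Ψ, indicator, h1, h2, h2']
    ring
  -- The free factor `c` serves twice: as `deriv F v` for the value of the integral and as `|deriv F
  -- v|` for its absolute convergence.
  have hτ : ∀ v σ c, Integrable (fun τ => (truncPow s T σ * (Ioi σ).indicator 1 v * c) *
      (τ ^ (-1 - s) * (Ici (v - σ)).indicator 1 τ)) μ ∧
      ∫ τ, (truncPow s T σ * (Ioi σ).indicator 1 v * c) *
      (τ ^ (-1 - s) * (Ici (v - σ)).indicator 1 τ) ∂μ =
      truncPow s T σ * (Ioi σ).indicator 1 v * c * ((v - σ) ^ (-s) / s) := by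
    intro v σ c
    by_cases h : σ < v
    · obtain ⟨h1, h2⟩ := integral_rpow_indicator hs0 (sub_pos.2 h)
      refine ⟨h1.const_mul _, ?_⟩
      rw [integral_const_mul, h2]
    · simp [indicator, h]
  have hσ : ∀ v c, 0 < v → Integrable (fun σ => truncPow s T σ * (Ioi σ).indicator 1 v *
      c * ((v - σ) ^ (-s) / s)) μ ∧
      ∫ σ, truncPow s T σ * (Ioi σ).indicator 1 v * c * ((v - σ) ^ (-s) / s) ∂μ =
      1 / s * (c * profile s (v / T)) := by
    intro v c hv
    obtain ⟨h1, h2⟩ := integrableOn_truncPow_mul (T := T) hs0 hs1 hv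
    have e : (fun σ => truncPow s T σ * (Ioi σ).indicator 1 v * c *
        ((v - σ) ^ (-s) / s)) = (Iio v).indicator (fun σ => (1 / s * c) *
          (truncPow s T σ * (v - σ) ^ (-s))) := by
      funext σ
      by_cases h : σ < v
      · simp [indicator, h]; ring
      · simp [indicator, h]
    have hset : Ioi (0 : ℝ) ∩ Iio v = Ioo 0 v := rfl
    rw [e]
    constructor
    · rw [integrable_indicator_iff measurableSet_Iio, IntegrableOn,
        Measure.restrict_restrict measurableSet_Iio, inter_comm, hset]
      exact h1.const_mul _
    · rw [setIntegral_indicator measurableSet_Iio, hset, integral_const_mul, h2]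
      ring
  have hind : ∀ (S : Set ℝ) x, ‖S.indicator (1 : ℝ → ℝ) x‖ = S.indicator 1 x := fun S x =>
    Real.norm_of_nonneg (indicator_nonneg (fun _ _ => zero_le_one) x)
  have hnorm : ∀ v σ τ, 0 < τ → 0 < σ → ‖Ψ ((v, σ), τ)‖ =
      (truncPow s T σ * (Ioi σ).indicator 1 v * |deriv F v|) *
      (τ ^ (-1 - s) * (Ici (v - σ)).indicator 1 τ) := by
    intro v σ τ hτ0 hσ0
    rw [hslice, norm_mul, norm_mul, norm_mul, norm_mul,
      Real.norm_of_nonneg (truncPow_nonneg hσ0.le),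
      Real.norm_of_nonneg (Real.rpow_nonneg hτ0.le _), hind, hind, Real.norm_eq_abs]
  have hnorm' : ∀ v σ, 0 < σ → ‖truncPow s T σ * (Ioi σ).indicator 1 v * deriv F v *
      ((v - σ) ^ (-s) / s)‖ = truncPow s T σ * (Ioi σ).indicator 1 v * |deriv F v| *
      ((v - σ) ^ (-s) / s) := by
    intro v σ hσ0
    by_cases h : σ < v
    · rw [norm_mul, norm_mul, norm_mul, Real.norm_of_nonneg (truncPow_nonneg hσ0.le), hind,
        Real.norm_of_nonneg (div_nonneg (Real.rpow_nonneg (sub_pos.2 h).le _) hs0.le),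
        Real.norm_eq_abs]
    · simp [indicator, h]
  have hprofm : Measurable (profile s) :=
    (continuous_iff_continuousAt.2 fun v => (hasDerivAt_profile hs0 hs1 v).continuousAt).measurable
  have hprod : Integrable (fun v => |deriv F v| * profile s (v / T)) μ := by
    refine (hi.mul_const (profile s 0)).norm.mono'
      ((measurable_deriv F).abs.mul (hprofm.comp (by fun_prop))).aestronglyMeasurable
      (Eventually.of_forall fun v => ?_)
    rw [norm_mul, norm_mul, Real.norm_eq_abs |deriv F v|, abs_abs]
    exact mul_le_mul_of_nonneg_left
      ((abs_profile_le hs0 hs1 _).trans (le_abs_self _)) (abs_nonneg _)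
  have hint2 : Integrable (fun q : ℝ × ℝ => truncPow s T q.2 * (Ioi q.2).indicator 1 q.1 *
      deriv F q.1 * ((q.1 - q.2) ^ (-s) / s)) (μ.prod μ) := by
    have hm2 : Measurable (fun q : ℝ × ℝ => truncPow s T q.2 * (Ioi q.2).indicator 1 q.1 *
      deriv F q.1 * ((q.1 - q.2) ^ (-s) / s)) := by
      have h1 := measurable_deriv F
      have h2 := measurable_truncPow s T
      have h3 : Measurable (fun q : ℝ × ℝ => (Ioi q.2).indicator (1 : ℝ → ℝ) q.1) := by
        have : Measurable ({q : ℝ × ℝ | q.2 < q.1}.indicator (1 : ℝ × ℝ → ℝ)) :=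
          measurable_one.indicator (measurableSet_lt measurable_snd measurable_fst)
        exact this
      fun_prop
    rw [integrable_prod_iff hm2.aestronglyMeasurable]
    constructor
    · filter_upwards [hμ] with v hv using (hσ v _ hv).1
    · refine (hprod.const_mul (1 / s)).congr ?_
      filter_upwards [hμ] with v hv
      rw [← (hσ v |deriv F v| hv).2]
      refine integral_congr_ae ?_
      filter_upwards [hμ] with σ hσ0 using (hnorm' v σ hσ0).symm
  have hΨ : Integrable Ψ ((μ.prod μ).prod μ) := by
    rw [integrable_prod_iff hmeas.aestronglyMeasurable]
    refine ⟨Eventually.of_forall fun q => ?_, ?_⟩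
    · exact (hτ q.1 q.2 (deriv F q.1)).1.congr
        (Eventually.of_forall fun τ => (hslice q.1 q.2 τ).symm)
    refine hint2.norm.congr ?_
    have h2 : ∀ᵐ q ∂(μ.prod μ), 0 < q.2 := Measure.quasiMeasurePreserving_snd.ae hμ
    filter_upwards [h2] with q hq
    rw [hnorm' q.1 q.2 hq, ← (hτ q.1 q.2 _).2]
    refine integral_congr_ae ?_
    filter_upwards [hμ] with τ hτ0 using (hnorm q.1 q.2 τ hτ0 hq).symm
  have e1 : ∫ q, Ψ q ∂((μ.prod μ).prod μ) =
      1 / s * ∫ v, deriv F v * profile s (v / T) ∂μ := by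
    rw [integral_prod _ hΨ]
    have h1 : ∀ q : ℝ × ℝ, ∫ τ, Ψ (q, τ) ∂μ = truncPow s T q.2 * (Ioi q.2).indicator 1 q.1 *
        deriv F q.1 * ((q.1 - q.2) ^ (-s) / s) := fun q => by
      rw [← (hτ q.1 q.2 _).2]
      exact integral_congr_ae (Eventually.of_forall fun τ => hslice q.1 q.2 τ)
    simp_rw [h1]
    rw [integral_prod _ hint2, ← integral_const_mul]
    refine integral_congr_ae ?_
    filter_upwards [hμ] with v hv using (hσ v _ hv).2
  -- The reverse order of integration, with `v` innermost, recovers the Marchaud expression.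
  have e2 : ∫ q, Ψ q ∂((μ.prod μ).prod μ) = -∫ τ, τ ^ (-1 - s) * ∫ σ,
      truncPow s T σ * (F σ - F (σ + τ)) ∂μ ∂μ := by
    rw [integral_prod_symm _ hΨ, ← integral_neg]
    refine integral_congr_ae ?_
    filter_upwards [hμ, hΨ.prod_left_ae] with τ hτ0 hτi
    rw [integral_prod_symm _ hτi, ← integral_const_mul, ← integral_neg]
    refine integral_congr_ae ?_
    filter_upwards [hμ] with σ hσ0
    have e : ∀ v, Ψ ((v, σ), τ) = τ ^ (-1 - s) * truncPow s T σ *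
        (Ioc σ (σ + τ)).indicator (deriv F) v := by
      intro v
      by_cases h1 : σ < v <;> by_cases h2 : v ≤ σ + τ <;> simp [Ψ, indicator, h1, h2]
      ring
    simp_rw [e]
    rw [integral_const_mul, integral_deriv_indicator hd hi hσ0 hτ0]
    ring
  rw [e1] at e2
  linarith

/-- Integration by parts in `integral_marchaud`. The boundary term at `0` produces the main term `F
0`; the one at infinity vanishes because `F` does beyond `M`. -/
lemma integral_marchaud_eq {s T : ℝ} (hs0 : 0 < s) (hs1 : s < 1)
    (hd : ∀ v, 0 < v → DifferentiableAt ℝ F v) (hc : Tendsto F (𝓝[>] 0) (𝓝 (F 0)))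
    (hM : ∀ v, M < v → F v = 0) {B : ℝ} (hB : ∀ v, |F v| ≤ B) (hm : Measurable F)
    (hb : ∀ v, 0 < v → |deriv F v| ≤ C * (1 + 1 / √v)) :
    ∫ τ in Ioi (0 : ℝ), τ ^ (-1 - s) * ∫ σ in Ioi (0 : ℝ),
      truncPow s T σ * (F σ - F (σ + τ)) =
    (1 / s) * (profile s 0 * F 0 + ∫ v in Ioi (0 : ℝ), T⁻¹ * profile' s (v / T) * F v) := by
  have hi := integrableOn_deriv_of_le hM hb
  rw [integral_marchaud hs0 hs1 hd hi]
  have hprof : Continuous (profile s) :=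
    continuous_iff_continuousAt.2 fun v => (hasDerivAt_profile hs0 hs1 v).continuousAt
  have hprof' : Continuous (profile' s) :=
    continuous_iff_continuousAt.2 fun v => (hasDerivAt_profile' hs0 hs1 v).continuousAt
  have hpd : ∀ v, HasDerivAt (fun v => profile s (v / T)) (T⁻¹ * profile' s (v / T)) v := by
    intro v
    have := (hasDerivAt_profile hs0 hs1 (v / T)).comp v ((hasDerivAt_id v).div_const T)
    exact this.congr_deriv (by rw [one_div]; ring)
  have hFH : Integrable ((deriv F) * fun v => profile s (v / T)) (volume.restrict (Ioi 0)) := by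
    refine (hi.mul_const (profile s 0)).norm.mono'
      ((measurable_deriv F).mul (hprof.measurable.comp (by fun_prop))).aestronglyMeasurable
      (Eventually.of_forall fun v => ?_)
    rw [Pi.mul_apply, norm_mul, norm_mul]
    exact mul_le_mul_of_nonneg_left
      ((abs_profile_le hs0 hs1 _).trans (le_abs_self _)) (norm_nonneg _)
  have hHF : IntegrableOn (F * fun v => T⁻¹ * profile' s (v / T)) (Ioi 0) := by
    rw [← Ioc_union_Ioi_eq_Ioi (le_max_right M 0)]
    refine IntegrableOn.union ?_ ?_
    · have h1 : IntegrableOn (fun v => T⁻¹ * profile' s (v / T)) (Ioc 0 (max M 0)) :=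
        (Continuous.integrableOn_Icc (by fun_prop)).mono_set Ioc_subset_Icc_self
      exact h1.bdd_mul hm.aestronglyMeasurable (Eventually.of_forall fun v => hB v)
    · refine integrableOn_zero.congr_fun (fun v hv => ?_) measurableSet_Ioi
      simp [hM v (lt_of_le_of_lt (le_max_left _ _) hv)]
  have h := integral_Ioi_mul_deriv_eq_deriv_mul (a := 0) (u := F)
    (v := fun v => profile s (v / T)) (u' := deriv F)
    (a' := F 0 * profile s 0) (b' := 0) (fun v hv => (hd v hv).hasDerivAt) (fun v _ => hpd v)
    hHF hFH ?_ ?_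
  · have e : ∫ v in Ioi (0 : ℝ), T⁻¹ * profile' s (v / T) * F v =
        ∫ v in Ioi (0 : ℝ), F v * (T⁻¹ * profile' s (v / T)) := by
      congr 1; funext v; ring
    rw [e, h]
    ring
  · refine hc.mul ?_
    have : Continuous fun v => profile s (v / T) := by fun_prop
    simpa using (this.tendsto 0).mono_left nhdsWithin_le_nhds
  · refine tendsto_const_nhds.congr' ?_
    filter_upwards [eventually_gt_atTop M] with v hv
    simp [hM v hv]

end Marchaud

/-! ### Weighted averages of translates of a test function. -/

section WeightedTranslates

variable {V F Ω : Type} [NormedAddCommGroup V] [NormedSpace ℝ V]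
  [NormedAddCommGroup F] [NormedSpace ℝ F]
  [MeasurableSpace Ω] {μ : Measure Ω} {w : Ω → ℝ} {a : Ω → V} {ψ : V → F}

lemma exists_bound_of_hasCompactSupport {V F : Type} [NormedAddCommGroup V]
    [NormedAddCommGroup F] {ψ : V → F} (hc : Continuous ψ) (hs : HasCompactSupport ψ) (k : ℕ) :
    ∃ C : ℝ, 0 ≤ C ∧ ∀ p, ‖p‖ ^ k * ‖ψ p‖ ≤ C := by
  obtain ⟨C, hC⟩ := (Continuous.mul (f := fun p : V => ‖p‖ ^ k) (g := fun p => ‖ψ p‖)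
    (by fun_prop) (by fun_prop)).bounded_above_of_compact_support
    (hs.norm.mul_left (f := fun p : V => ‖p‖ ^ k))
  exact ⟨C, (norm_nonneg _).trans (hC 0), fun p => (le_abs_self _).trans (hC p)⟩

lemma aestronglyMeasurable_translates {V F : Type} [NormedAddCommGroup V]
    [NormedAddCommGroup F] [NormedSpace ℝ F] {a : Ω → V} {ψ : V → F} (hc : Continuous ψ) (hw : AEStronglyMeasurable w μ)
    (ha : AEStronglyMeasurable a μ) (p : V) :
    AEStronglyMeasurable (fun z => w z • ψ (p - a z)) μ :=
  hw.smul (hc.comp_aestronglyMeasurable (aestronglyMeasurable_const.sub ha))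

lemma integrable_translates {V F : Type} [NormedAddCommGroup V]
    [NormedAddCommGroup F] [NormedSpace ℝ F] {a : Ω → V} {ψ : V → F} (hc : Continuous ψ) (hs : HasCompactSupport ψ)
    (hw : Integrable w μ) (ha : AEStronglyMeasurable a μ) (p : V) :
    Integrable (fun z => w z • ψ (p - a z)) μ := by
  obtain ⟨C, -, hC⟩ := exists_bound_of_hasCompactSupport hc hs 0
  refine (hw.norm.mul_const C).mono' (aestronglyMeasurable_translates hc hw.1 ha p)
    (Eventually.of_forall fun z => ?_)
  rw [norm_smul]
  exact mul_le_mul_of_nonneg_left (by simpa using hC (p - a z)) (norm_nonneg _)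

lemma hasFDerivAt_integral_translates [CompleteSpace F] (hψ : ContDiff ℝ ∞ ψ) (hs : HasCompactSupport ψ)
    (hw : Integrable w μ) (ha : AEStronglyMeasurable a μ) (p : V) :
    HasFDerivAt (fun p => ∫ z, w z • ψ (p - a z) ∂μ)
      (∫ z, w z • fderiv ℝ ψ (p - a z) ∂μ) p := by
  have hd : Continuous (fderiv ℝ ψ) := hψ.continuous_fderiv (by simp)
  obtain ⟨C, -, hC⟩ := exists_bound_of_hasCompactSupport hd (hs.fderiv ℝ) 0
  refine hasFDerivAt_integral_of_dominated_of_fderiv_le (bound := fun z => ‖w z‖ * C)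
    (F' := fun p z => w z • fderiv ℝ ψ (p - a z))
    (Metric.ball_mem_nhds p one_pos) ?_ ?_ ?_ ?_ ?_ ?_
  · exact Eventually.of_forall fun q =>
      aestronglyMeasurable_translates hψ.continuous hw.1 ha q
  · exact integrable_translates hψ.continuous hs hw ha p
  · exact aestronglyMeasurable_translates hd hw.1 ha p
  · refine Eventually.of_forall fun z q _ => ?_
    rw [norm_smul]
    exact mul_le_mul_of_nonneg_left (by simpa using hC (q - a z)) (norm_nonneg _)
  · exact hw.norm.mul_const C
  · refine Eventually.of_forall fun z q _ => ?_
    have h := ((hψ.differentiable (by simp)) (q - a z)).hasFDerivAt.comp q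
      ((hasFDerivAt_id q).sub_const (a z))
    exact h.const_smul (w z)

/-- The derivative is an integral of the same kind with `fderiv ℝ ψ` for `ψ`, hence the induction
with `F` varying. -/
lemma contDiff_integral_translates [CompleteSpace F] (hψ : ContDiff ℝ ∞ ψ) (hs : HasCompactSupport ψ)
    (hw : Integrable w μ) (ha : AEStronglyMeasurable a μ) :
    ContDiff ℝ ∞ (fun p => ∫ z, w z • ψ (p - a z) ∂μ) := by
  rw [contDiff_infty]
  intro m
  induction m generalizing F with
  | zero =>
    exact contDiff_zero.2 (continuous_iff_continuousAt.2 fun p =>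
      (hasFDerivAt_integral_translates hψ hs hw ha p).continuousAt)
  | succ m ih =>
    have h := hasFDerivAt_integral_translates hψ hs hw ha
    push_cast
    rw [contDiff_succ_iff_fderiv]
    refine ⟨fun p => (h p).differentiableAt, by simp, ?_⟩
    rw [funext fun p => (h p).fderiv]
    exact ih (contDiff_infty_iff_fderiv.1 hψ).2 (hs.fderiv ℝ)

/-- All derivatives fall on `ψ`, which reduces to `m = 0`. There `‖p‖ ≤ ‖p - a z‖ + ‖a z‖`: the
first summand is absorbed by the compact support of `ψ`, the second by the moments of `w`. -/
lemma decay_integral_translates [CompleteSpace F] (hψ : ContDiff ℝ ∞ ψ) (hs : HasCompactSupport ψ)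
    (ha : AEStronglyMeasurable a μ) (hw : ∀ k : ℕ, Integrable (fun z => w z * ‖a z‖ ^ k) μ)
    (k m : ℕ) : ∃ C : ℝ, ∀ p,
      ‖p‖ ^ k * ‖iteratedFDeriv ℝ m (fun p => ∫ z, w z • ψ (p - a z) ∂μ) p‖ ≤ C := by
  have hw0 : Integrable w μ := by simpa using hw 0
  induction m generalizing F with
  | zero =>
    obtain ⟨C, hC0, hC⟩ := exists_bound_of_hasCompactSupport hψ.continuous hs 0
    obtain ⟨D, hD0, hD⟩ := exists_bound_of_hasCompactSupport hψ.continuous hs k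
    refine ⟨∫ z, 2 ^ k * (‖w z‖ * D + ‖w z * ‖a z‖ ^ k‖ * C) ∂μ, fun p => ?_⟩
    rw [norm_iteratedFDeriv_zero]
    have hk : ‖p‖ ^ k * ‖∫ z, w z • ψ (p - a z) ∂μ‖ =
        ‖∫ z, (‖p‖ ^ k) • (w z • ψ (p - a z)) ∂μ‖ := by
      rw [integral_smul, norm_smul, norm_pow, norm_norm]
    rw [hk]
    refine norm_integral_le_of_norm_le (((hw0.norm.mul_const D).add
      ((hw k).norm.mul_const C)).const_mul _) (Eventually.of_forall fun z => ?_)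
    have h1 : ‖p‖ ^ k ≤ 2 ^ k * (‖p - a z‖ ^ k + ‖a z‖ ^ k) := by
      have h2 : ‖p‖ ≤ ‖p - a z‖ + ‖a z‖ := by
        simpa using norm_add_le (p - a z) (a z)
      calc ‖p‖ ^ k ≤ (‖p - a z‖ + ‖a z‖) ^ k := by gcongr
        _ ≤ 2 ^ (k - 1) * (‖p - a z‖ ^ k + ‖a z‖ ^ k) :=
          add_pow_le (norm_nonneg _) (norm_nonneg _) k
        _ ≤ _ := by
          gcongr
          · norm_num
          · omega
    have h3 := hC (p - a z)
    have h4 := hD (p - a z)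
    rw [pow_zero, one_mul] at h3
    rw [norm_smul, norm_smul, norm_mul, norm_pow, norm_pow, norm_norm, norm_norm]
    calc ‖p‖ ^ k * (‖w z‖ * ‖ψ (p - a z)‖)
        ≤ 2 ^ k * (‖p - a z‖ ^ k + ‖a z‖ ^ k) * (‖w z‖ * ‖ψ (p - a z)‖) := by gcongr
      _ = 2 ^ k * (‖w z‖ * (‖p - a z‖ ^ k * ‖ψ (p - a z)‖) +
          ‖w z‖ * ‖a z‖ ^ k * ‖ψ (p - a z)‖) := by ring
      _ ≤ _ := by gcongr
  | succ m ih =>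
    obtain ⟨C, hC⟩ := ih (contDiff_infty_iff_fderiv.1 hψ).2 (hs.fderiv ℝ)
    refine ⟨C, fun p => ?_⟩
    rw [← norm_iteratedFDeriv_fderiv,
      funext fun p => (hasFDerivAt_integral_translates hψ hs hw0 ha p).fderiv]
    exact hC p

/-- A weighted average of translates of a test function, all moments being finite, is a Schwartz
function. -/
def translatesSchwartz [CompleteSpace F] (w : Ω → ℝ) (a : Ω → V) (ψ : V → F) (hψ : ContDiff ℝ ∞ ψ)
    (hs : HasCompactSupport ψ) (ha : AEStronglyMeasurable a μ)
    (hw : ∀ k : ℕ, Integrable (fun z => w z * ‖a z‖ ^ k) μ) : 𝓢(V, F) where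
  toFun p := ∫ z, w z • ψ (p - a z) ∂μ
  smooth' := contDiff_integral_translates hψ hs (by simpa using hw 0) ha
  decay' := decay_integral_translates hψ hs ha hw

end WeightedTranslates

/-! ### The truncated potential and its image under the right operator. -/

/-- The translations by `(√σ y, -σ)` have all moments: `σ` is bounded by `2T` on the support of the
cutoff, and the Gaussian has all moments in `y`. -/
lemma integrable_truncPow_heatKernel {s T : ℝ} (hs0 : 0 < s) (hT : 0 < T) (k : ℕ) :
    Integrable (fun q : ℝ × EuclideanSpace ℝ (Fin n) =>
      truncPow s T q.1 * heatKernel n 1 q.2 * ‖((√q.1 • q.2, -q.1) : SpaceTime n)‖ ^ k)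
      ((volume.restrict (Ioi 0)).prod volume) := by
  have h1 := integrableOn_truncPow hs0 hT
  have h2 : IntegrableOn (fun σ => (√(2 * T) ^ k) * truncPow s T σ) (Ioi 0) := h1.const_mul _
  have h3 : IntegrableOn (fun σ => ((2 * T) ^ k) * truncPow s T σ) (Ioi 0) := h1.const_mul _
  have h := (h2.mul_prod (integrable_heatKernel_one_mul_pow (n := n) k)).add
    (h3.mul_prod (integrable_heatKernel (n := n) one_pos))
  refine h.mono' ?_ ?_
  · have := measurable_truncPow s T
    have := (continuous_heatKernel (n := n) 1).measurable
    exact Measurable.aestronglyMeasurable (by fun_prop)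
  · have hq : ∀ᵐ q ∂((volume.restrict (Ioi (0 : ℝ))).prod
        (volume : Measure (EuclideanSpace ℝ (Fin n)))), 0 < q.1 :=
      Measure.quasiMeasurePreserving_fst.ae (ae_restrict_mem measurableSet_Ioi)
    filter_upwards [hq] with q hq0
    have hk := truncPow_nonneg (s := s) (T := T) hq0.le
    have hG := heatKernel_nonneg (n := n) zero_le_one q.2
    rw [Real.norm_of_nonneg (by positivity)]
    by_cases hle : 2 * T ≤ q.1
    · simp [truncPow_eq_zero hT hle]
    push Not at hle
    have h5 : ‖((√q.1 • q.2, -q.1) : SpaceTime n)‖ ^ k ≤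
        (√(2 * T) * ‖q.2‖) ^ k + (2 * T) ^ k := by
      rw [Prod.norm_mk, norm_smul, norm_neg, Real.norm_of_nonneg hq0.le,
        Real.norm_of_nonneg (Real.sqrt_nonneg _)]
      rcases le_total (√q.1 * ‖q.2‖) q.1 with h | h
      · rw [max_eq_right h]
        have : q.1 ^ k ≤ (2 * T) ^ k := by gcongr
        have : 0 ≤ (√(2 * T) * ‖q.2‖) ^ k := by positivity
        linarith
      · rw [max_eq_left h]
        have : (√q.1 * ‖q.2‖) ^ k ≤ (√(2 * T) * ‖q.2‖) ^ k := by gcongr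
        have : 0 ≤ (2 * T) ^ k := by positivity
        linarith
    calc _ ≤ truncPow s T q.1 * heatKernel n 1 q.2 *
          ((√(2 * T) * ‖q.2‖) ^ k + (2 * T) ^ k) := by gcongr
      _ = _ := by simp only [Pi.add_apply]; rw [mul_pow]; ring

lemma aestronglyMeasurable_heatShift (μ : Measure (ℝ × EuclideanSpace ℝ (Fin n))) :
    AEStronglyMeasurable (fun q : ℝ × EuclideanSpace ℝ (Fin n) =>
      ((√q.1 • q.2, -q.1) : SpaceTime n)) μ :=
  Continuous.aestronglyMeasurable (by fun_prop)

/-- The truncation at time scale `T` of `Γ(s) (∂ₜ - Δ)_right^(-s) ψ`. -/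
def truncPotential {s T : ℝ} (hs0 : 0 < s) (hT : 0 < T) (ψ : SpaceTime n → ℝ)
    (hψ : ContDiff ℝ ∞ ψ) (hs : HasCompactSupport ψ) : 𝓢(SpaceTime n, ℝ) :=
  translatesSchwartz (fun q : ℝ × EuclideanSpace ℝ (Fin n) =>
      truncPow s T q.1 * heatKernel n 1 q.2) (fun q => ((√q.1 • q.2, -q.1) : SpaceTime n)) ψ hψ hs
    (aestronglyMeasurable_heatShift _) (integrable_truncPow_heatKernel hs0 hT)

lemma truncPotential_apply {s T : ℝ} (hs0 : 0 < s) (hT : 0 < T) {ψ : SpaceTime n → ℝ}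
    (hψ : ContDiff ℝ ∞ ψ) (hs : HasCompactSupport ψ) (p : SpaceTime n) :
    truncPotential hs0 hT ψ hψ hs p = ∫ σ in Ioi 0, truncPow s T σ * heatAvg ψ σ p := by
  have hi := integrable_translates (a := fun q : ℝ × EuclideanSpace ℝ (Fin n) =>
    ((√q.1 • q.2, -q.1) : SpaceTime n)) hψ.continuous hs
    (by simpa using integrable_truncPow_heatKernel (n := n) hs0 hT 0)
    (aestronglyMeasurable_heatShift _) p
  change ∫ q, _ ∂_ = _
  rw [integral_prod _ hi]
  congr 1
  funext σ
  simp only [smul_eq_mul, mul_assoc, heatAvg]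
  rw [integral_const_mul]
  congr 2
  funext y
  congr 2
  ext1 <;> simp

lemma setIntegral_Ioi_comp_add (g : ℝ → ℝ) (t : ℝ) :
    ∫ τ in Ioi t, g τ = ∫ τ in Ioi 0, g (t + τ) := by
  have h := (measurePreserving_add_left (volume : Measure ℝ) t).setIntegral_preimage_emb
    (measurableEmbedding_addLeft t) g (Ioi t)
  simpa using h.symm

/-- `rightOp` of a real function through the heat kernel. -/
lemma rightOp_ofReal {s : ℝ} {φ : SpaceTime n → ℝ} (hc : Continuous φ) {C : ℝ}
    (hb : ∀ q, |φ q| ≤ C) (p : SpaceTime n) :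
    rightOp n s (fun q => (φ q : ℂ)) p =
      ((normConst n s * (4 * Real.pi) ^ ((n : ℝ) / 2) * ∫ τ in Ioi (0 : ℝ),
        τ ^ (-1 - s) * (φ p - ∫ y, heatKernel n τ (p.1 - y) * φ (y, p.2 + τ)) : ℝ) : ℂ) := by
  unfold rightOp
  simp_rw [← Complex.ofReal_sub, ← Complex.ofReal_mul, integral_complex_ofReal,
    ← Complex.ofReal_mul]
  congr 1
  rw [mul_assoc, setIntegral_Ioi_comp_add]
  congr 1
  rw [← integral_const_mul]
  refine setIntegral_congr_fun (μ := volume) (s := Ioi (0 : ℝ)) measurableSet_Ioi fun τ hτ => ?_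
  have hτ0 : (0 : ℝ) < τ := hτ
  have h1 : Integrable (fun y => heatKernel n τ (p.1 - y)) :=
    (integrable_heatKernel hτ0).comp_sub_left p.1
  have h2 : Integrable (fun y => heatKernel n τ (p.1 - y) * φ (y, p.2 + τ)) := by
    refine (h1.mul_const C).mono' ?_
      (Eventually.of_forall fun y => norm_heatKernel_mul_le hb hτ0.le _ _)
    exact (((continuous_heatKernel τ).comp (by fun_prop)).mul
      (hc.comp (by fun_prop))).aestronglyMeasurable
  have h3 : ∫ y, heatKernel n τ (p.1 - y) = 1 := by
    rw [integral_sub_left_eq_self, integral_heatKernel hτ0]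
  have h4 : φ p - ∫ y, heatKernel n τ (p.1 - y) * φ (y, p.2 + τ) =
      ∫ y, heatKernel n τ (p.1 - y) * (φ p - φ (y, p.2 + τ)) := by
    simp_rw [mul_sub]
    rw [integral_sub (h1.mul_const _) h2, integral_mul_const, h3, one_mul]
  rw [h4, ← integral_const_mul, ← integral_const_mul]
  congr 1
  funext y
  rw [← mul_assoc, ← mul_assoc, add_sub_cancel_left]
  congr 1
  unfold heatKernel
  rw [Real.mul_rpow (by positivity) hτ0.le, neg_div (2 : ℝ) (n : ℝ), Real.rpow_neg (by positivity),
    show (n : ℝ) / 2 + 1 + s = (n : ℝ) / 2 + -(-1 - s) by ring, Real.rpow_add hτ0,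
    Real.rpow_neg hτ0.le (-1 - s), Real.rpow_neg hτ0.le]
  have : (4 * Real.pi) ^ ((n : ℝ) / 2) ≠ 0 := by positivity
  have : τ ^ ((n : ℝ) / 2) ≠ 0 := by positivity
  have : τ ^ (-1 - s) ≠ 0 := by positivity
  field_simp

lemma integrableOn_truncPow_mul_heatAvg {s T : ℝ} (hs0 : 0 < s) (hT : 0 < T)
    {ψ : SpaceTime n → ℝ} (hc : Continuous ψ) {C : ℝ} (hb : ∀ q, |ψ q| ≤ C) (τ : ℝ)
    (p : SpaceTime n) :
    IntegrableOn (fun σ => truncPow s T σ * heatAvg ψ (σ + τ) p) (Ioi 0) := by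
  have := (continuous_heatAvg hc hb).comp (g := fun q : ℝ × SpaceTime n => heatAvg ψ q.1 q.2)
    (f := fun σ => (σ + τ, p)) (by fun_prop)
  exact (integrableOn_truncPow hs0 hT).mul_bdd (c := C) this.aestronglyMeasurable
    (Eventually.of_forall fun σ => abs_heatAvg_le hb _ _)

/-- By Fubini and the semigroup law, `P_τ` acts on the potential by shifting `σ` to `σ + τ`. This
makes the right operator one-dimensional. -/
lemma integral_heatKernel_mul_potential {s T : ℝ} (hs0 : 0 < s) (hT : 0 < T)
    {ψ : SpaceTime n → ℝ} (hc : Continuous ψ) {C : ℝ} (hb : ∀ q, |ψ q| ≤ C) {τ : ℝ} (hτ : 0 < τ)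
    (p : SpaceTime n) :
    ∫ y, heatKernel n τ (p.1 - y) *
      (∫ σ in Ioi 0, truncPow s T σ * heatAvg ψ σ (y, p.2 + τ)) =
    ∫ σ in Ioi 0, truncPow s T σ * heatAvg ψ (σ + τ) p := by
  have h1 : Integrable (fun y => heatKernel n τ (p.1 - y)) :=
    (integrable_heatKernel hτ).comp_sub_left p.1
  have hi : Integrable (fun q : EuclideanSpace ℝ (Fin n) × ℝ => heatKernel n τ (p.1 - q.1) *
      (truncPow s T q.2 * heatAvg ψ q.2 (q.1, p.2 + τ)))
      (volume.prod (volume.restrict (Ioi 0))) := by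
    have h := (h1.mul_prod (integrableOn_truncPow (s := s) hs0 hT)).mul_bdd (c := C)
      (g := fun q : EuclideanSpace ℝ (Fin n) × ℝ => heatAvg ψ q.2 (q.1, p.2 + τ))
      ((continuous_heatAvg hc hb).comp (g := fun q : ℝ × SpaceTime n => heatAvg ψ q.1 q.2)
        (f := fun q : EuclideanSpace ℝ (Fin n) × ℝ => (q.2, (q.1, p.2 + τ)))
        (by fun_prop)).aestronglyMeasurable
      (Eventually.of_forall fun q => abs_heatAvg_le hb _ _)
    exact h.congr (Eventually.of_forall fun q => mul_assoc _ _ _)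
  simp_rw [← integral_const_mul]
  rw [integral_integral_swap hi]
  refine setIntegral_congr_fun measurableSet_Ioi fun σ hσ => ?_
  simp_rw [mul_left_comm _ (truncPow s T σ)]
  rw [integral_const_mul, heatAvg_heatAvg hc hb hσ hτ, add_comm]

/-- `rightOp` inverts the truncated potential up to a smoothing error. -/
theorem rightOp_truncPotential {s T : ℝ} (hs0 : 0 < s) (hs1 : s < 1) (hT : 0 < T)
    {ψ : SpaceTime n → ℝ} (hψ : ContDiff ℝ ∞ ψ) (hs : HasCompactSupport ψ) (p : SpaceTime n) :
    rightOp n s (fun q => (truncPotential hs0 hT ψ hψ hs q : ℂ)) p =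
      ((normConst n s * (4 * Real.pi) ^ ((n : ℝ) / 2) / s *
        (profile s 0 * ψ p +
          ∫ v in Ioi (0 : ℝ), T⁻¹ * profile' s (v / T) * heatAvg ψ v p) : ℝ) : ℂ) := by
  have hc := hψ.continuous
  obtain ⟨C, -, hC⟩ := exists_bound_of_hasCompactSupport hc hs 0
  have hb : ∀ q, |ψ q| ≤ C := fun q => by simpa using hC q
  obtain ⟨C₁, -, hC₁⟩ := exists_bound_of_hasCompactSupport
    (hψ.continuous_fderiv (by simp)) (hs.fderiv ℝ) 0
  obtain ⟨R, hR⟩ := hs.isCompact.isBounded.exists_norm_le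
  have hR' : ∀ q : SpaceTime n, R < |q.2| → ψ q = 0 := by
    intro q hq
    by_contra h
    have h1 := hR q (subset_tsupport _ h)
    have h2 : |q.2| ≤ ‖q‖ := norm_snd_le q
    linarith
  obtain ⟨C', hC'0, hC'⟩ := exists_abs_deriv_heatAvg_le (hψ.of_le (by exact_mod_cast le_top))
    (C := max C C₁) (fun q => (hb q).trans (le_max_left _ _))
    (fun q => (le_trans (by simp) (hC₁ q)).trans (le_max_right _ _))
  have hcont : Continuous fun v => heatAvg ψ v p :=
    (continuous_heatAvg hc hb).comp (g := fun q : ℝ × SpaceTime n => heatAvg ψ q.1 q.2)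
    (f := fun v => (v, p)) (by fun_prop)
  -- Here `F v = P_v ψ (p)`. It vanishes for `v > R - p.2`, because `ψ` has bounded support in time.
  have key := integral_marchaud_eq (T := T) (F := fun v => heatAvg ψ v p) (M := R - p.2) (B := C)
    hs0 hs1 (fun v hv => (hC' p v hv).1) ((hcont.tendsto 0).mono_left nhdsWithin_le_nhds)
    (fun v hv => heatAvg_eq_zero hR' (lt_of_lt_of_le (by linarith) (le_abs_self _)))
    (fun v => abs_heatAvg_le hb v p) hcont.measurable (fun v hv => (hC' p v hv).2)
  have hφb : ∀ q, |truncPotential hs0 hT ψ hψ hs q| ≤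
      SchwartzMap.seminorm ℝ 0 0 (truncPotential hs0 hT ψ hψ hs) := fun q => by
    rw [← Real.norm_eq_abs]
    exact SchwartzMap.norm_le_seminorm ℝ _ q
  rw [rightOp_ofReal (SchwartzMap.continuous _) hφb]
  congr 1
  rw [div_eq_mul_one_div _ s, mul_assoc _ (1 / s)]
  congr 1
  rw [heatAvg_zero] at key
  rw [← key]
  refine setIntegral_congr_fun measurableSet_Ioi fun τ hτ => ?_
  simp only [truncPotential_apply]
  rw [integral_heatKernel_mul_potential hs0 hT hc hb hτ]
  congr 1
  rw [← integral_sub]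
  · simp_rw [mul_sub]
  · simpa [IntegrableOn] using integrableOn_truncPow_mul_heatAvg hs0 hT hc hb 0 p
  · exact integrableOn_truncPow_mul_heatAvg hs0 hT hc hb τ p

/-! ### Gaussian bounds and comparison with the weight. -/

/-- A Gaussian majorant of the heat kernel and of its scaled derivatives. -/
def gaussMajorant (n : ℕ) (v : ℝ) (z : EuclideanSpace ℝ (Fin n)) : ℝ :=
  v ^ (-(n : ℝ) / 2) * Real.exp (-‖z‖ ^ 2 / (8 * v))

/-- Half of the exponent absorbs the linear factor. This loss explains the `8v` in `gaussMajorant`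
against the `4v` in the heat kernel. -/
lemma mul_exp_neg_le (c : ℝ) {a : ℝ} (hc : 0 ≤ c) (ha : 0 ≤ a) :
    (c + a) * Real.exp (-a) ≤ (c + 2) * Real.exp (-(a / 2)) := by
  have h1 : Real.exp (-a) = Real.exp (-(a / 2)) * Real.exp (-(a / 2)) := by
    rw [← Real.exp_add]; congr 1; ring
  have h2 : a * Real.exp (-(a / 2)) ≤ 2 := by
    have h := Real.add_one_le_exp (a / 2)
    rw [Real.exp_neg, ← div_eq_mul_inv, div_le_iff₀ (Real.exp_pos _)]
    linarith
  have h3 : Real.exp (-(a / 2)) ≤ 1 := Real.exp_le_one_iff.2 (by linarith)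
  rw [h1, ← mul_assoc]
  refine mul_le_mul_of_nonneg_right ?_ (Real.exp_pos _).le
  rw [add_mul]
  nlinarith

lemma mul_heatKernel_le {v : ℝ} (hv : 0 < v) {c : ℝ} (hc : 0 ≤ c)
    (z : EuclideanSpace ℝ (Fin n)) :
    (c + ‖z‖ ^ 2 / (4 * v)) * heatKernel n v z ≤ (c + 2) * gaussMajorant n v z := by
  have h1 : (4 * Real.pi * v) ^ (-(n : ℝ) / 2) ≤ v ^ (-(n : ℝ) / 2) := by
    refine Real.rpow_le_rpow_of_nonpos hv ?_ ?_
    · nlinarith [Real.pi_gt_three]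
    · have : (0 : ℝ) ≤ n := Nat.cast_nonneg n
      linarith
  have h2 := mul_exp_neg_le c (a := ‖z‖ ^ 2 / (4 * v)) hc (by positivity)
  have e1 : -‖z‖ ^ 2 / (4 * v) = -(‖z‖ ^ 2 / (4 * v)) := by ring
  have e2 : -‖z‖ ^ 2 / (8 * v) = -(‖z‖ ^ 2 / (4 * v) / 2) := by ring
  unfold heatKernel gaussMajorant
  rw [e1, e2]
  calc _ = (4 * Real.pi * v) ^ (-(n : ℝ) / 2) *
        ((c + ‖z‖ ^ 2 / (4 * v)) * Real.exp (-(‖z‖ ^ 2 / (4 * v)))) := by ring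
    _ ≤ v ^ (-(n : ℝ) / 2) * ((c + 2) * Real.exp (-(‖z‖ ^ 2 / (4 * v) / 2))) := by gcongr
    _ = _ := by ring

lemma heatKernel_le {v : ℝ} (hv : 0 < v) (z : EuclideanSpace ℝ (Fin n)) :
    heatKernel n v z ≤ 3 * gaussMajorant n v z := by
  have h := mul_heatKernel_le hv zero_le_one z
  have h1 : 0 ≤ ‖z‖ ^ 2 / (4 * v) * heatKernel n v z :=
    mul_nonneg (by positivity) (heatKernel_nonneg hv.le z)
  linarith

lemma hasDerivAt_heatKernel_time {v : ℝ} (hv : 0 < v) (z : EuclideanSpace ℝ (Fin n)) :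
    HasDerivAt (fun v => heatKernel n v z)
      (1 / v * (-(n : ℝ) / 2 + ‖z‖ ^ 2 / (4 * v)) * heatKernel n v z) v := by
  have h1 : HasDerivAt (fun v : ℝ => (4 * Real.pi * v) ^ (-(n : ℝ) / 2))
      ((4 * Real.pi) * (-(n : ℝ) / 2) * (4 * Real.pi * v) ^ (-(n : ℝ) / 2 - 1)) v := by
    have := ((hasDerivAt_id v).const_mul (4 * Real.pi)).rpow_const (p := -(n : ℝ) / 2)
      (Or.inl (by simp only [id]; positivity))
    simpa using this
  have h2 : HasDerivAt (fun v : ℝ => Real.exp (-‖z‖ ^ 2 / (4 * v)))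
      (Real.exp (-‖z‖ ^ 2 / (4 * v)) * (‖z‖ ^ 2 / (4 * v ^ 2))) v := by
    have h3 : HasDerivAt (fun v : ℝ => -‖z‖ ^ 2 / (4 * v)) (‖z‖ ^ 2 / (4 * v ^ 2)) v := by
      have := (hasDerivAt_const v (-‖z‖ ^ 2)).div ((hasDerivAt_id v).const_mul 4)
        (by simp only [id]; positivity)
      refine this.congr_deriv ?_
      simp only [id]
      field_simp
      ring
    exact h3.exp
  refine (h1.mul h2).congr_deriv ?_
  unfold heatKernel
  rw [Real.rpow_sub_one (by positivity)]
  field_simp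

lemma abs_deriv_heatKernel_time_le {v : ℝ} (hv : 0 < v) (z : EuclideanSpace ℝ (Fin n)) :
    |1 / v * (-(n : ℝ) / 2 + ‖z‖ ^ 2 / (4 * v)) * heatKernel n v z| ≤
      1 / v * ((n / 2 + 2) * gaussMajorant n v z) := by
  rw [abs_mul, abs_mul, abs_of_pos (show 0 < 1 / v by positivity),
    abs_of_nonneg (heatKernel_nonneg hv.le z), mul_assoc]
  refine mul_le_mul_of_nonneg_left (le_trans ?_ (mul_heatKernel_le hv (c := n / 2)
    (by positivity) z)) (by positivity)
  refine mul_le_mul_of_nonneg_right ((abs_add_le _ _).trans ?_) (heatKernel_nonneg hv.le z)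
  rw [abs_div, abs_neg, abs_two, Nat.abs_cast, abs_of_nonneg (by positivity : 0 ≤ ‖z‖ ^ 2 / (4 * v))]

lemma abs_taylor_le {g g' g'' : ℝ → ℝ} (h1 : ∀ r, HasDerivAt g (g' r) r)
    (h2 : ∀ r, HasDerivAt g' (g'' r) r) {B : ℝ} (hB : ∀ r ∈ Icc (0 : ℝ) 1, |g'' r| ≤ B) :
    |g 1 - g 0 - g' 0| ≤ B := by
  have hB0 : 0 ≤ B := (abs_nonneg _).trans (hB 0 (by simp))
  have e1 : ∀ r ∈ Icc (0 : ℝ) 1, |g' r - g' 0| ≤ B := by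
    intro r hr
    have := (convex_Icc (0 : ℝ) 1).norm_image_sub_le_of_norm_hasDerivWithin_le
      (fun x _ => (h2 x).hasDerivWithinAt) hB (x := 0) (by simp) hr
    refine this.trans (mul_le_of_le_one_right hB0 ?_)
    rw [sub_zero, Real.norm_of_nonneg hr.1]
    exact hr.2
  have e2 := (convex_Icc (0 : ℝ) 1).norm_image_sub_le_of_norm_hasDerivWithin_le
      (f := fun r => g r - g' 0 * r) (f' := fun r => g' r - g' 0)
      (fun x _ => ((h1 x).sub (by simpa using (hasDerivAt_id x).const_mul (g' 0))).hasDerivWithinAt)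
      e1 (x := 0) (y := 1) (by simp) (by simp)
  rw [sub_zero, norm_one, Real.norm_eq_abs] at e2
  convert e2 using 2 <;> ring

/-- Second order Taylor formula along the segment from `x` to `x - y`. The second derivative is the
kernel times `a'² - ‖y‖² / (2v)`, and by Cauchy-Schwarz this factor is at most `‖y‖² / v` times `1 +
‖x - r y‖² / (4v)`, which the majorant absorbs with constant `1 + 2`. -/
lemma abs_heatKernel_taylor_le {v : ℝ} (hv : 0 < v) (x y : EuclideanSpace ℝ (Fin n)) {B : ℝ}
    (hB : ∀ r ∈ Icc (0 : ℝ) 1, gaussMajorant n v (x - r • y) ≤ B) :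
    |heatKernel n v (x - y) - heatKernel n v x - heatKernel n v x * (inner ℝ x y / (2 * v))| ≤
      ‖y‖ ^ 2 / v * (3 * B) := by
  let a' : ℝ → ℝ := fun r => inner ℝ (x - r • y) y / (2 * v)
  have hlin : ∀ r : ℝ, HasDerivAt (fun r : ℝ => x - r • y) (-y) r := fun r => by
    simpa using ((hasDerivAt_id r).smul_const y).const_sub x
  have hk : ∀ r : ℝ, HasDerivAt (fun r : ℝ => heatKernel n v (x - r • y))
      (heatKernel n v (x - r • y) * a' r) r := by
    intro r
    have h1 := ((hlin r).norm_sq.fun_neg.div_const (4 * v)).exp.const_mul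
      ((4 * Real.pi * v) ^ (-(n : ℝ) / 2))
    refine h1.congr_deriv ?_
    simp only [heatKernel, a', inner_neg_right]
    field_simp
    ring
  have ha' : ∀ r : ℝ, HasDerivAt a' (-(‖y‖ ^ 2 / (2 * v))) r := by
    intro r
    have h1 := ((hlin r).inner ℝ (hasDerivAt_const r y)).div_const (2 * v)
    refine h1.congr_deriv ?_
    simp [inner_neg_left]
    ring
  have hk' : ∀ r : ℝ, HasDerivAt (fun r : ℝ => heatKernel n v (x - r • y) * a' r)
      (heatKernel n v (x - r • y) * (a' r ^ 2 - ‖y‖ ^ 2 / (2 * v))) r := by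
    intro r
    refine ((hk r).mul (ha' r)).congr_deriv ?_
    ring
  have h := abs_taylor_le hk hk' (B := ‖y‖ ^ 2 / v * (3 * B)) ?_
  · simpa [a'] using h
  · intro r hr
    have hG := heatKernel_nonneg hv.le (x - r • y)
    rw [abs_mul, abs_of_nonneg hG]
    have h1 : a' r ^ 2 ≤ ‖y‖ ^ 2 / v * (‖x - r • y‖ ^ 2 / (4 * v)) := by
      have h2 := abs_real_inner_le_norm (x - r • y) y
      have h3 : (inner ℝ (x - r • y) y) ^ 2 ≤ (‖x - r • y‖ * ‖y‖) ^ 2 := by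
        rw [← sq_abs]; gcongr
      simp only [a']
      rw [div_pow, div_mul_div_comm, div_le_div_iff₀ (by positivity) (by positivity)]
      nlinarith [sq_nonneg v, mul_le_mul_of_nonneg_right h3 (sq_nonneg v)]
    have h4 : |a' r ^ 2 - ‖y‖ ^ 2 / (2 * v)| ≤
        ‖y‖ ^ 2 / v * (1 + ‖x - r • y‖ ^ 2 / (4 * v)) := by
      have h5 : ‖y‖ ^ 2 / (2 * v) ≤ ‖y‖ ^ 2 / v := by
        gcongr; linarith
      have h6 : 0 ≤ ‖y‖ ^ 2 / (2 * v) := by positivity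
      have h7 := sq_nonneg (a' r)
      have h8 : 0 ≤ ‖y‖ ^ 2 / v * (‖x - r • y‖ ^ 2 / (4 * v)) := by positivity
      rw [abs_le]
      constructor <;> linarith
    have h9 := mul_heatKernel_le hv zero_le_one (x - r • y)
    have h10 := hB r hr
    calc _ ≤ heatKernel n v (x - r • y) *
          (‖y‖ ^ 2 / v * (1 + ‖x - r • y‖ ^ 2 / (4 * v))) := by gcongr
      _ = ‖y‖ ^ 2 / v * ((1 + ‖x - r • y‖ ^ 2 / (4 * v)) * heatKernel n v (x - r • y)) := by
        ring
      _ ≤ ‖y‖ ^ 2 / v * ((1 + 2) * B) := by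
        refine mul_le_mul_of_nonneg_left ?_ (by positivity)
        linarith
      _ = _ := by ring

lemma add_rpow_le_two_rpow {a b p : ℝ} (ha : 0 ≤ a) (hb : 0 ≤ b) (hp : 0 ≤ p) :
    (a + b) ^ p ≤ 2 ^ p * (a ^ p + b ^ p) := by
  have hap := Real.rpow_nonneg ha p
  have hbp := Real.rpow_nonneg hb p
  rcases le_total a b with h | h
  · calc (a + b) ^ p ≤ (2 * b) ^ p := Real.rpow_le_rpow (by positivity) (by linarith) hp
      _ = 2 ^ p * b ^ p := Real.mul_rpow two_pos.le hb
      _ ≤ _ := by gcongr; linarith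
  · calc (a + b) ^ p ≤ (2 * a) ^ p := Real.rpow_le_rpow (by positivity) (by linarith) hp
      _ = 2 ^ p * a ^ p := Real.mul_rpow two_pos.le ha
      _ ≤ _ := by gcongr; linarith

lemma weight_pos (s : ℝ) (p : SpaceTime n) : 0 < weight n s p := by
  unfold weight; positivity

/-- The Gaussian majorant, with the time decay of order `1 + s`, is dominated by the inverse of the
weight, uniformly under bounded translations. -/
lemma exists_gaussMajorant_mul_weight_le {s : ℝ} (hs0 : 0 < s) {R : ℝ} (hR : 0 ≤ R) :
    ∃ C : ℝ, 0 ≤ C ∧ ∀ (p : SpaceTime n) (z : EuclideanSpace ℝ (Fin n)) (v : ℝ), 1 ≤ v →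
      ‖p.1 - z‖ ≤ R → |p.2 + v| ≤ R →
      v ^ (-1 - s) * gaussMajorant n v z ≤ C / weight n s p := by
  set β : ℝ := (n : ℝ) / 2 + 1 + s with hβ
  have hβ0 : 0 ≤ β := by positivity
  obtain ⟨A, hA0, hA⟩ := exists_rpow_mul_exp_neg_le (a := β) (b := 1 / 8) hβ0 (by norm_num)
  -- The three summands bound the contributions of the three terms of the weight.
  set C := 1 + 2 ^ (2 * β) * (A + R ^ (2 * β)) + 2 ^ β * (1 + R ^ β) with hC
  refine ⟨C, by positivity, fun p z v hv hz ht => ?_⟩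
  have hv0 : 0 < v := by linarith
  rw [le_div_iff₀ (weight_pos s p)]
  have hexp : Real.exp (-‖z‖ ^ 2 / (8 * v)) ≤ 1 := by
    rw [Real.exp_le_one_iff]
    have : 0 ≤ ‖z‖ ^ 2 / (8 * v) := by positivity
    rw [neg_div]; linarith
  have hvβ : v ^ (-β) ≤ 1 := Real.rpow_le_one_of_one_le_of_nonpos hv (by linarith)
  have hvβ0 : 0 < v ^ (-β) := Real.rpow_pos_of_pos hv0 _
  have hvv : v ^ (-β) * v ^ β = 1 := by rw [← Real.rpow_add hv0]; simp
  set m := v ^ (-β) * Real.exp (-‖z‖ ^ 2 / (8 * v)) with hm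
  have hm0 : 0 ≤ m := by positivity
  have hm1 : m ≤ 1 := mul_le_one₀ hvβ (Real.exp_pos _).le hexp
  have e : v ^ (-1 - s) * gaussMajorant n v z = m := by
    unfold gaussMajorant
    rw [← mul_assoc, ← Real.rpow_add hv0, hm]
    congr 2
    rw [hβ]; ring
  have hmv : m * v ^ β ≤ 1 := by
    calc m * v ^ β = (v ^ (-β) * v ^ β) * Real.exp (-‖z‖ ^ 2 / (8 * v)) := by rw [hm]; ring
      _ ≤ 1 := by rw [hvv, one_mul]; exact hexp
  have hmz : m * ‖z‖ ^ (2 * β) ≤ A := by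
    have h1 := hA (‖z‖ ^ 2 / v) (by positivity)
    have h2 : (‖z‖ ^ 2 / v) ^ β = ‖z‖ ^ (2 * β) * v ^ (-β) := by
      rw [Real.div_rpow (by positivity) hv0.le, Real.rpow_neg hv0.le, ← Real.rpow_natCast,
        ← Real.rpow_mul (norm_nonneg _), div_eq_mul_inv]
      norm_num
    have h3 : -(1 / 8) * (‖z‖ ^ 2 / v) = -‖z‖ ^ 2 / (8 * v) := by field_simp
    rw [h2, h3] at h1
    calc _ = ‖z‖ ^ (2 * β) * v ^ (-β) * Real.exp (-‖z‖ ^ 2 / (8 * v)) := by rw [hm]; ring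
      _ ≤ A := h1
  have hx : ‖p.1‖ ^ (2 * β) ≤ 2 ^ (2 * β) * (‖z‖ ^ (2 * β) + R ^ (2 * β)) := by
    refine le_trans (Real.rpow_le_rpow (norm_nonneg _) ?_ (by positivity))
      (add_rpow_le_two_rpow (norm_nonneg z) hR (by positivity))
    calc ‖p.1‖ = ‖z + (p.1 - z)‖ := by simp
      _ ≤ ‖z‖ + R := (norm_add_le _ _).trans (by linarith)
  have htt : |p.2| ^ β ≤ 2 ^ β * (v ^ β + R ^ β) := by
    refine le_trans (Real.rpow_le_rpow (abs_nonneg _) ?_ hβ0)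
      (add_rpow_le_two_rpow hv0.le hR hβ0)
    have := abs_le.1 ht
    rw [abs_le]
    constructor <;> linarith
  have hw : weight n s p = 1 + ‖p.1‖ ^ (2 * β) + |p.2| ^ β := by
    unfold weight
    rw [hβ, show (n : ℝ) + 2 + 2 * s = 2 * ((n : ℝ) / 2 + 1 + s) by ring]
  rw [e, hw]
  calc m * (1 + ‖p.1‖ ^ (2 * β) + |p.2| ^ β)
      ≤ m * (1 + 2 ^ (2 * β) * (‖z‖ ^ (2 * β) + R ^ (2 * β)) + 2 ^ β * (v ^ β + R ^ β)) := by
        gcongr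
    _ = m + 2 ^ (2 * β) * (m * ‖z‖ ^ (2 * β) + m * R ^ (2 * β)) +
        2 ^ β * (m * v ^ β + m * R ^ β) := by ring
    _ ≤ 1 + 2 ^ (2 * β) * (A + 1 * R ^ (2 * β)) + 2 ^ β * (1 + 1 * R ^ β) := by gcongr
    _ = C := by rw [hC]; ring

/-! ### The smoothing error and its parabolic Taylor expansion. -/

/-- The kernel of the smoothing error `ψ ↦ ∫ T⁻¹ H'(v/T) P_v ψ dv`. -/
def errorKernel (n : ℕ) (s T : ℝ) (z : EuclideanSpace ℝ (Fin n)) (v : ℝ) : ℝ :=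
  T⁻¹ * profile' s (v / T) * heatKernel n v z

lemma errorKernel_eq_zero {s T v : ℝ} (hT : 0 < T) (hv : v ≤ T) (z : EuclideanSpace ℝ (Fin n)) :
    errorKernel n s T z v = 0 := by
  rw [errorKernel, profile'_eq_zero, mul_zero, zero_mul]
  rwa [div_le_one hT]

lemma measurable_errorKernel {s T : ℝ} (hs0 : 0 < s) (hs1 : s < 1) :
    Measurable fun q : EuclideanSpace ℝ (Fin n) × ℝ => errorKernel n s T q.1 q.2 := by
  have : Measurable (profile' s) := (continuous_iff_continuousAt.2 fun v =>
    (hasDerivAt_profile' hs0 hs1 v).continuousAt).measurable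
  unfold errorKernel heatKernel
  fun_prop

lemma gaussMajorant_nonneg {v : ℝ} (hv : 0 ≤ v) (z : EuclideanSpace ℝ (Fin n)) :
    0 ≤ gaussMajorant n v z := by
  unfold gaussMajorant; positivity

/-- Scaled decay of the profile. -/
lemma exists_profile'_scaled_le {s : ℝ} (hs0 : 0 < s) (hs1 : s < 1) :
    ∃ C : ℝ, 0 ≤ C ∧ ∀ T v : ℝ, 0 < T → T ≤ v →
      |T⁻¹ * profile' s (v / T)| * (1 / v) ≤ C * T ^ (s - 1) * v ^ (-1 - s) ∧
      |T⁻¹ * (T⁻¹ * profile'' s (v / T))| ≤ C * T ^ (s - 1) * v ^ (-1 - s) := by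
  obtain ⟨C, hC0, hC⟩ := exists_abs_profile'_le hs0 hs1
  refine ⟨C, hC0, fun T v hT hv => ?_⟩
  have hv0 : 0 < v := hT.trans_le hv
  obtain ⟨h1, h2⟩ := hC (v / T) (by positivity)
  have e : T⁻¹ * T⁻¹ * (v / T) ^ (-1 - s) = T ^ (s - 1) * v ^ (-1 - s) := by
    rw [Real.div_rpow hv0.le hT.le, show -1 - s = -(1 + s) by ring, Real.rpow_neg hT.le,
      show s - 1 = (1 + s) - 1 - 1 by ring, Real.rpow_sub_one hT.ne', Real.rpow_sub_one hT.ne']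
    field_simp
  -- The gain `1/v` is exchanged for `1/T`: this turns the growing factor `T^s` into the decaying
  -- `T^(s-1)`.
  have h3 : 1 / v ≤ T⁻¹ := by
    rw [one_div]; exact inv_anti₀ hT hv
  constructor
  · rw [abs_mul, abs_of_pos (inv_pos.2 hT), mul_assoc C, ← e]
    calc T⁻¹ * |profile' s (v / T)| * (1 / v)
        ≤ T⁻¹ * (C * (v / T) ^ (-1 - s)) * T⁻¹ := by gcongr
      _ = _ := by ring
  · rw [abs_mul, abs_mul, abs_of_pos (inv_pos.2 hT), mul_assoc C, ← e]
    calc T⁻¹ * (T⁻¹ * |profile'' s (v / T)|)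
        ≤ T⁻¹ * (T⁻¹ * (C * (v / T) ^ (-1 - s))) := by gcongr
      _ = _ := by ring

/-- A time derivative falls on the profile, gaining `1/T`, or on the heat kernel, gaining `1/v ≤
1/T`. Below `T` the kernel vanishes identically, so it is differentiable for `v ≤ 0` as well. -/
lemma exists_deriv_errorKernel_le {s : ℝ} (hs0 : 0 < s) (hs1 : s < 1) :
    ∃ C : ℝ, 0 ≤ C ∧ ∀ (T : ℝ), 0 < T → ∀ (z : EuclideanSpace ℝ (Fin n)) (v : ℝ),
      ∃ d : ℝ, HasDerivAt (errorKernel n s T z) d v ∧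
        (v ≤ T → d = 0) ∧
        (T ≤ v → |d| ≤ C * T ^ (s - 1) * (v ^ (-1 - s) * gaussMajorant n v z)) := by
  obtain ⟨C, hC0, hC⟩ := exists_profile'_scaled_le hs0 hs1
  refine ⟨C * (n / 2 + 5), by positivity, fun T hT z v => ?_⟩
  have hf : HasDerivAt (fun v => T⁻¹ * profile' s (v / T)) (T⁻¹ * (T⁻¹ * profile'' s (v / T))) v := by
    have := (((hasDerivAt_profile' hs0 hs1 (v / T)).comp v
      ((hasDerivAt_id v).div_const T))).const_mul T⁻¹
    exact this.congr_deriv (by rw [one_div]; ring)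
  rcases lt_or_ge v T with hvT | hvT
  · refine ⟨0, ?_, fun _ => rfl, fun h => absurd h (not_le.2 hvT)⟩
    refine (hasDerivAt_const v (0 : ℝ)).congr_of_eventuallyEq ?_
    filter_upwards [Iio_mem_nhds hvT] with w hw
    exact errorKernel_eq_zero hT (le_of_lt hw) z
  · have hv0 : 0 < v := hT.trans_le hvT
    refine ⟨_, hf.mul (hasDerivAt_heatKernel_time hv0 z), fun h => ?_, fun _ => ?_⟩
    · have h1 : v / T ≤ 1 := by rwa [div_le_one hT]
      rw [profile'_eq_zero h1, profile''_eq_zero h1]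
      simp
    · obtain ⟨h1, h2⟩ := hC T v hT hvT
      have h3 := abs_deriv_heatKernel_time_le hv0 z
      have h4 := heatKernel_le hv0 z
      have hG := heatKernel_nonneg hv0.le z
      have hM := gaussMajorant_nonneg hv0.le z
      refine (abs_add_le _ _).trans ?_
      rw [abs_mul, abs_mul _ (1 / v * _ * _), abs_of_nonneg hG]
      calc _ ≤ (C * T ^ (s - 1) * v ^ (-1 - s)) * (3 * gaussMajorant n v z) +
            |T⁻¹ * profile' s (v / T)| * (1 / v * ((n / 2 + 2) * gaussMajorant n v z)) := by
            gcongr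
        _ = (C * T ^ (s - 1) * v ^ (-1 - s)) * (3 * gaussMajorant n v z) +
            |T⁻¹ * profile' s (v / T)| * (1 / v) * ((n / 2 + 2) * gaussMajorant n v z) := by
            ring
        _ ≤ (C * T ^ (s - 1) * v ^ (-1 - s)) * (3 * gaussMajorant n v z) +
            (C * T ^ (s - 1) * v ^ (-1 - s)) * ((n / 2 + 2) * gaussMajorant n v z) := by
            gcongr
        _ = _ := by ring

/-- The first order parabolic Taylor remainder of the error kernel. -/
def errorRemainder (n : ℕ) (s T : ℝ) (p q : SpaceTime n) : ℝ :=
  errorKernel n s T (p.1 - q.1) (q.2 - p.2) - errorKernel n s T p.1 (-p.2) -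
    errorKernel n s T p.1 (-p.2) * (inner ℝ p.1 q.1 / (2 * -p.2))

/-- The increment is split into a step in time, bounded by the mean value inequality, and a step in
space, bounded by the second order Taylor formula. Both have the size `T^(s-1) v^(-1-s)` times a
Gaussian, which the weight controls because `v ≥ T ≥ 1`. -/
lemma exists_errorRemainder_le {s : ℝ} (hs0 : 0 < s) (hs1 : s < 1) {R : ℝ} (hR : 0 ≤ R) :
    ∃ C : ℝ, 0 ≤ C ∧ ∀ (T : ℝ), 1 ≤ T → ∀ p q : SpaceTime n, ‖q‖ ≤ R →
      |errorRemainder n s T p q| ≤ C * T ^ (s - 1) / weight n s p := by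
  obtain ⟨A, hA0, hA⟩ := exists_gaussMajorant_mul_weight_le (n := n) hs0 hR
  obtain ⟨B, hB0, hB⟩ := exists_deriv_errorKernel_le (n := n) hs0 hs1
  obtain ⟨D, hD0, hD⟩ := exists_profile'_scaled_le hs0 hs1
  refine ⟨B * A * R + D * (R ^ 2 * (3 * A)), by positivity, fun T hT p q hq => ?_⟩
  have hT0 : 0 < T := by linarith
  have hTs : 0 < T ^ (s - 1) := Real.rpow_pos_of_pos hT0 _
  have hw := weight_pos s p
  have hq1 : ‖q.1‖ ≤ R := (norm_fst_le q).trans hq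
  have hq2 : |q.2| ≤ R := (norm_snd_le q).trans hq
  have h1 : |errorKernel n s T (p.1 - q.1) (q.2 - p.2) - errorKernel n s T (p.1 - q.1) (-p.2)| ≤
      B * T ^ (s - 1) * (A / weight n s p) * R := by
    choose d hd hd0 hdb using hB T hT0 (p.1 - q.1)
    have hbound : ∀ v ∈ Icc (-p.2 - R) (-p.2 + R), ‖d v‖ ≤ B * T ^ (s - 1) * (A / weight n s p) := by
      intro v hv
      rcases le_total v T with h | h
      · rw [hd0 v h, norm_zero]; positivity
      · refine (hdb v h).trans ?_
        refine mul_le_mul_of_nonneg_left ?_ (by positivity)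
        refine hA p _ v (hT.trans h) (by simpa using hq1) ?_
        rw [abs_le]
        constructor <;> linarith [hv.1, hv.2]
    have := (convex_Icc (-p.2 - R) (-p.2 + R)).norm_image_sub_le_of_norm_hasDerivWithin_le
      (fun x _ => (hd x).hasDerivWithinAt) hbound (x := -p.2) (y := q.2 - p.2)
      ⟨by linarith, by linarith⟩
      ⟨by linarith [(abs_le.1 hq2).1], by linarith [(abs_le.1 hq2).2]⟩
    rw [show q.2 - p.2 - -p.2 = q.2 by ring] at this
    refine this.trans (mul_le_mul_of_nonneg_left hq2 (by positivity))
  have h2 : |errorKernel n s T (p.1 - q.1) (-p.2) - errorKernel n s T p.1 (-p.2) -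
      errorKernel n s T p.1 (-p.2) * (inner ℝ p.1 q.1 / (2 * -p.2))| ≤
      D * T ^ (s - 1) * (R ^ 2 * (3 * (A / weight n s p))) := by
    rcases le_total (-p.2) T with h | h
    · rw [errorKernel_eq_zero hT0 h, errorKernel_eq_zero hT0 h]
      simp only [sub_zero, zero_mul, abs_zero]
      positivity
    · have hv0 : 0 < -p.2 := by linarith
      have hvs : 0 < (-p.2) ^ (-1 - s) := Real.rpow_pos_of_pos hv0 _
      -- The comparison with the weight is divided by `(-p.2)^(-1-s)` to isolate the Gaussian; the
      -- factor is restored by the decay of the profile.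
      have h3 := abs_heatKernel_taylor_le hv0 p.1 q.1
        (B := A / weight n s p / (-p.2) ^ (-1 - s)) (fun r hr => by
          rw [le_div_iff₀ hvs, mul_comm]
          refine hA p _ _ (by linarith) ?_ (by simpa using hR)
          rw [sub_sub_cancel, norm_smul, Real.norm_of_nonneg hr.1]
          exact (mul_le_of_le_one_left (norm_nonneg _) hr.2).trans hq1)
      have h4 := (hD T (-p.2) hT0 h).1
      have e : errorKernel n s T (p.1 - q.1) (-p.2) - errorKernel n s T p.1 (-p.2) -
          errorKernel n s T p.1 (-p.2) * (inner ℝ p.1 q.1 / (2 * -p.2)) =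
          T⁻¹ * profile' s (-p.2 / T) * (heatKernel n (-p.2) (p.1 - q.1) -
            heatKernel n (-p.2) p.1 - heatKernel n (-p.2) p.1 *
              (inner ℝ p.1 q.1 / (2 * -p.2))) := by
        unfold errorKernel; ring
      rw [e, abs_mul]
      calc _ ≤ |T⁻¹ * profile' s (-p.2 / T)| *
            (‖q.1‖ ^ 2 / -p.2 * (3 * (A / weight n s p / (-p.2) ^ (-1 - s)))) :=
            mul_le_mul_of_nonneg_left h3 (abs_nonneg _)
        _ ≤ |T⁻¹ * profile' s (-p.2 / T)| *
            (R ^ 2 / -p.2 * (3 * (A / weight n s p / (-p.2) ^ (-1 - s)))) := by gcongr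
        _ = |T⁻¹ * profile' s (-p.2 / T)| * (1 / -p.2) *
            (R ^ 2 * (3 * (A / weight n s p / (-p.2) ^ (-1 - s)))) := by ring
        _ ≤ D * T ^ (s - 1) * (-p.2) ^ (-1 - s) *
            (R ^ 2 * (3 * (A / weight n s p / (-p.2) ^ (-1 - s)))) := by gcongr
        _ = _ := by field_simp
  unfold errorRemainder
  calc _ = |(errorKernel n s T (p.1 - q.1) (q.2 - p.2) - errorKernel n s T (p.1 - q.1) (-p.2)) +
      (errorKernel n s T (p.1 - q.1) (-p.2) - errorKernel n s T p.1 (-p.2) -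
      errorKernel n s T p.1 (-p.2) * (inner ℝ p.1 q.1 / (2 * -p.2)))| := by congr 1; ring
    _ ≤ _ := (abs_add_le _ _).trans (add_le_add h1 h2)
    _ = _ := by ring

/-- The error, evaluated on a test function with vanishing moments of order `0` and `1`. -/
lemma integral_error_eq {s T : ℝ} (hs0 : 0 < s) (hs1 : s < 1) (hT : 1 ≤ T)
    {ψ : SpaceTime n → ℝ} (hc : Continuous ψ) (hs : HasCompactSupport ψ)
    (h0 : ∫ q, ψ q = 0) (h1 : ∀ w, ∫ q : SpaceTime n, inner ℝ w q.1 * ψ q = 0)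
    (p : SpaceTime n) :
    ∫ v in Ioi (0 : ℝ), T⁻¹ * profile' s (v / T) * heatAvg ψ v p =
      ∫ q, errorRemainder n s T p q * ψ q := by
  have hT0 : 0 < T := by linarith
  have hψi : Integrable ψ := hc.integrable_of_hasCompactSupport hs
  have hψi' : Integrable fun q : SpaceTime n => inner ℝ p.1 q.1 * ψ q :=
    (Continuous.integrable_of_hasCompactSupport (by fun_prop)
      (hs.mul_left (f := fun q : SpaceTime n => inner ℝ p.1 q.1)))
  obtain ⟨R, hR⟩ := hs.isCompact.isBounded.exists_norm_le
  have hR' : ∀ q, ψ q ≠ 0 → ‖q‖ ≤ max R 0 := fun q hq =>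
    (hR q (subset_tsupport _ hq)).trans (le_max_left _ _)
  obtain ⟨C, hC0, hC⟩ := exists_errorRemainder_le (n := n) hs0 hs1 (le_max_right R 0)
  have hmeas : Measurable fun q : SpaceTime n => errorKernel n s T (p.1 - q.1) (q.2 - p.2) :=
    (measurable_errorKernel hs0 hs1).comp (f := fun q : SpaceTime n => (p.1 - q.1, q.2 - p.2))
      (by fun_prop)
  have hrem : Integrable fun q => errorRemainder n s T p q * ψ q := by
    refine (hψi.norm.const_mul (C * T ^ (s - 1) / weight n s p)).mono' ?_
      (Eventually.of_forall fun q => ?_)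
    · refine Measurable.aestronglyMeasurable ?_
      have := hc.measurable
      unfold errorRemainder
      fun_prop
    · rw [norm_mul]
      by_cases hq : ψ q = 0
      · simp [hq]
      · exact mul_le_mul_of_nonneg_right (hC T hT p q (hR' q hq)) (norm_nonneg _)
  have hlin : Integrable fun q : SpaceTime n => errorKernel n s T p.1 (-p.2) * ψ q +
      errorKernel n s T p.1 (-p.2) / (2 * -p.2) * (inner ℝ p.1 q.1 * ψ q) :=
    (hψi.const_mul _).add (hψi'.const_mul _)
  -- The moment conditions remove exactly the affine part of the expansion.
  have hlin0 : ∫ q : SpaceTime n, (errorKernel n s T p.1 (-p.2) * ψ q +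
      errorKernel n s T p.1 (-p.2) / (2 * -p.2) * (inner ℝ p.1 q.1 * ψ q)) = 0 := by
    rw [integral_add (hψi.const_mul _) (hψi'.const_mul _), integral_const_mul,
      integral_const_mul, h0, h1]
    simp
  have hsplit : ∀ q : SpaceTime n, errorKernel n s T (p.1 - q.1) (q.2 - p.2) * ψ q =
      errorRemainder n s T p q * ψ q + (errorKernel n s T p.1 (-p.2) * ψ q +
      errorKernel n s T p.1 (-p.2) / (2 * -p.2) * (inner ℝ p.1 q.1 * ψ q)) := by
    intro q
    unfold errorRemainder
    ring
  have hker : Integrable fun q : SpaceTime n =>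
      errorKernel n s T (p.1 - q.1) (q.2 - p.2) * ψ q := by
    simp_rw [hsplit]
    exact hrem.add hlin
  have e1 : ∫ q : SpaceTime n, errorKernel n s T (p.1 - q.1) (q.2 - p.2) * ψ q =
      ∫ q, errorRemainder n s T p q * ψ q := by
    simp_rw [hsplit]
    rw [integral_add hrem hlin, hlin0, add_zero]
  rw [← e1]
  have e2 : ∫ v in Ioi (0 : ℝ), T⁻¹ * profile' s (v / T) * heatAvg ψ v p =
      ∫ v, T⁻¹ * profile' s (v / T) * heatAvg ψ v p := by
    refine setIntegral_eq_integral_of_forall_compl_eq_zero fun v hv => ?_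
    rw [profile'_eq_zero, mul_zero, zero_mul]
    rw [div_le_one hT0]
    exact (not_lt.1 hv).trans hT0.le
  have e3 : ∀ v, T⁻¹ * profile' s (v / T) * heatAvg ψ v p =
      ∫ z, errorKernel n s T (p.1 - z) v * ψ (z, p.2 + v) := by
    intro v
    rcases le_or_gt v T with h | h
    · simp_rw [errorKernel_eq_zero hT0 h]
      rw [profile'_eq_zero (by rwa [div_le_one hT0])]
      simp
    · rw [heatAvg_eq_integral ψ (hT0.trans h), ← integral_const_mul]
      simp only [errorKernel, mul_assoc]
  rw [e2]
  simp_rw [e3]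
  -- Fubini and the substitution `τ = p.2 + v` turn the average over `v` into an integral over
  -- space-time.
  rw [Measure.volume_eq_prod, integral_prod_symm _ hker,
    ← integral_sub_right_eq_self (fun v => ∫ z, errorKernel n s T (p.1 - z) v * ψ (z, p.2 + v)) p.2]
  simp

/-- The smoothing error is small in the weighted uniform norm. -/
theorem exists_error_le {s : ℝ} (hs0 : 0 < s) (hs1 : s < 1)
    {ψ : SpaceTime n → ℝ} (hc : Continuous ψ) (hs : HasCompactSupport ψ)
    (h0 : ∫ q, ψ q = 0) (h1 : ∀ w, ∫ q : SpaceTime n, inner ℝ w q.1 * ψ q = 0) :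
    ∃ C : ℝ, ∀ T : ℝ, 1 ≤ T → ∀ p : SpaceTime n,
      |∫ v in Ioi (0 : ℝ), T⁻¹ * profile' s (v / T) * heatAvg ψ v p| ≤
        C * T ^ (s - 1) / weight n s p := by
  have hψi : Integrable ψ := hc.integrable_of_hasCompactSupport hs
  obtain ⟨R, hR⟩ := hs.isCompact.isBounded.exists_norm_le
  obtain ⟨C, hC0, hC⟩ := exists_errorRemainder_le (n := n) hs0 hs1 (le_max_right R 0)
  refine ⟨C * ∫ q, ‖ψ q‖, fun T hT p => ?_⟩
  rw [integral_error_eq hs0 hs1 hT hc hs h0 h1 p]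
  have h := norm_integral_le_of_norm_le (f := fun q => errorRemainder n s T p q * ψ q)
    (hψi.norm.const_mul (C * T ^ (s - 1) / weight n s p)) (Eventually.of_forall fun q => by
      rw [norm_mul]
      by_cases hq : ψ q = 0
      · simp [hq]
      · exact mul_le_mul_of_nonneg_right
          (hC T hT p q ((hR q (subset_tsupport _ hq)).trans (le_max_left _ _))) (norm_nonneg _))
  rw [integral_const_mul] at h
  refine h.trans_eq ?_
  ring

/-! ### Solutions are affine in space and constant in time. -/

lemma normConst_pos {s : ℝ} (hs0 : 0 < s) (hs1 : s < 1) : 0 < normConst n s := by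
  have h : Real.Gamma (-s) ≠ 0 := by
    refine Real.Gamma_ne_zero fun m hm => ?_
    have h1 : s = m := by linarith
    rw [h1] at hs0 hs1
    have : 0 < m := by exact_mod_cast hs0
    have : m < 1 := by exact_mod_cast hs1
    omega
  unfold normConst
  positivity

lemma measurable_error {s T : ℝ} (hs0 : 0 < s) (hs1 : s < 1)
    {ψ : SpaceTime n → ℝ} (hc : Continuous ψ) {C : ℝ} (hb : ∀ q, |ψ q| ≤ C) :
    StronglyMeasurable fun p : SpaceTime n =>
      ∫ v in Ioi (0 : ℝ), T⁻¹ * profile' s (v / T) * heatAvg ψ v p := by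
  have hp : Continuous (profile' s) := continuous_iff_continuousAt.2 fun v =>
    (hasDerivAt_profile' hs0 hs1 v).continuousAt
  have h : Continuous fun q : SpaceTime n × ℝ =>
      T⁻¹ * profile' s (q.2 / T) * heatAvg ψ q.2 q.1 :=
    Continuous.mul (by fun_prop) ((continuous_heatAvg hc hb).comp
      (g := fun q : ℝ × SpaceTime n => heatAvg ψ q.1 q.2)
      (f := fun q : SpaceTime n × ℝ => (q.2, q.1)) (by fun_prop))
  exact h.stronglyMeasurable.integral_prod_right

/-- A solution annihilates the test functions with vanishing moments of order `0` and `1`. -/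
theorem integral_mul_eq_zero {s : ℝ} (hs0 : 0 < s) (hs1 : s < 1) {u : SpaceTime n → ℝ}
    (hu : MemSlowlyIncreasing n s u) (hsol : IsDistributionalSolution n s u)
    {ψ : SpaceTime n → ℝ} (hψ : ContDiff ℝ ∞ ψ) (hs : HasCompactSupport ψ)
    (h0 : ∫ q, ψ q = 0) (h1 : ∀ w, ∫ q : SpaceTime n, inner ℝ w q.1 * ψ q = 0) :
    ∫ p, u p * ψ p = 0 := by
  obtain ⟨hloc, hint⟩ := hu
  have hc := hψ.continuous
  obtain ⟨B, -, hB⟩ := exists_bound_of_hasCompactSupport hc hs 0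
  have hb : ∀ q, |ψ q| ≤ B := fun q => by simpa using hB q
  obtain ⟨C, hC⟩ := exists_error_le hs0 hs1 hc hs h0 h1
  have huψ : Integrable fun p => u p * ψ p := by
    simpa [mul_comm] using hloc.integrable_smul_left_of_hasCompactSupport hc hs
  have hH := profile_zero_pos hs0 hs1
  have key : ∀ T : ℝ, 1 ≤ T →
      |∫ p, u p * ψ p| ≤ (profile s 0)⁻¹ * (C * T ^ (s - 1) * ∫ p, |u p| / weight n s p) := by
    intro T hT
    have hT0 : 0 < T := by linarith
    set err : SpaceTime n → ℝ := fun p =>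
      ∫ v in Ioi (0 : ℝ), T⁻¹ * profile' s (v / T) * heatAvg ψ v p with herr
    have hbd : ∀ p, ‖u p * err p‖ ≤ C * T ^ (s - 1) * (|u p| / weight n s p) := by
      intro p
      rw [norm_mul, Real.norm_eq_abs]
      calc _ ≤ |u p| * (C * T ^ (s - 1) / weight n s p) :=
            mul_le_mul_of_nonneg_left (hC T hT p) (abs_nonneg _)
        _ = _ := by ring
    have hui : Integrable fun p => u p * err p :=
      (hint.const_mul (C * T ^ (s - 1))).mono'
        (hloc.aestronglyMeasurable.mul (measurable_error hs0 hs1 hc hb).aestronglyMeasurable)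
        (Eventually.of_forall hbd)
    have hsum : ∫ p, u p * (profile s 0 * ψ p + err p) = 0 := by
      have h := hsol ((truncPotential hs0 hT0 ψ hψ hs).postcompCLM Complex.ofRealCLM)
      have e : ∀ p, rightOp n s ((truncPotential hs0 hT0 ψ hψ hs).postcompCLM
          Complex.ofRealCLM) p = _ := fun p => rightOp_truncPotential hs0 hs1 hT0 hψ hs p
      simp_rw [e, Complex.conj_ofReal, ← Complex.ofReal_mul] at h
      rw [integral_complex_ofReal, Complex.ofReal_eq_zero] at h
      simp_rw [mul_left_comm (u _)] at h
      rw [integral_const_mul] at h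
      refine (mul_eq_zero.1 h).resolve_left ?_
      have := normConst_pos (n := n) hs0 hs1
      positivity
    have hsplit : profile s 0 * ∫ p, u p * ψ p = -∫ p, u p * err p := by
      have e : ∀ p, u p * (profile s 0 * ψ p + err p) =
          profile s 0 * (u p * ψ p) + u p * err p := fun p => by ring
      simp_rw [e] at hsum
      rw [integral_add (huψ.const_mul _) hui, integral_const_mul] at hsum
      linarith
    have hle : |∫ p, u p * err p| ≤ C * T ^ (s - 1) * ∫ p, |u p| / weight n s p := by
      have := norm_integral_le_of_norm_le (hint.const_mul (C * T ^ (s - 1)))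
        (Eventually.of_forall hbd)
      rwa [integral_const_mul] at this
    have e2 : ∫ p, u p * ψ p = (profile s 0)⁻¹ * -∫ p, u p * err p := by
      rw [← hsplit]; field_simp
    rw [e2, abs_mul, abs_neg, abs_of_pos (inv_pos.2 hH)]
    gcongr
  -- Since `s < 1`, `T^(s-1) → 0`, whereas the left side of `key` does not depend on `T`.
  have hlim : Tendsto (fun T : ℝ =>
      (profile s 0)⁻¹ * (C * T ^ (s - 1) * ∫ p, |u p| / weight n s p)) atTop (𝓝 0) := by
    have h := tendsto_rpow_neg_atTop (y := 1 - s) (by linarith)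
    rw [neg_sub] at h
    simpa using ((h.const_mul C).mul_const (∫ p, |u p| / weight n s p)).const_mul (profile s 0)⁻¹
  have := ge_of_tendsto hlim (eventually_atTop.2 ⟨1, key⟩)
  exact abs_eq_zero.1 (le_antisymm this (abs_nonneg _))

/-- The space of real test functions. -/
def testFunctions (n : ℕ) : Submodule ℝ (SpaceTime n → ℝ) where
  carrier := {ψ | ContDiff ℝ ∞ ψ ∧ HasCompactSupport ψ}
  add_mem' h1 h2 := ⟨h1.1.add h2.1, h1.2.add h2.2⟩
  zero_mem' := ⟨contDiff_const, HasCompactSupport.zero⟩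
  smul_mem' c _ h := ⟨contDiff_const.smul h.1, h.2.smul_left (f := fun _ => c)⟩

lemma integrable_mul_testFunction {g : SpaceTime n → ℝ} (hg : LocallyIntegrable g)
    (ψ : testFunctions n) : Integrable fun p => g p * ψ.1 p := by
  simpa [mul_comm] using hg.integrable_smul_left_of_hasCompactSupport ψ.2.1.continuous ψ.2.2

/-- The functional `ψ ↦ ∫ g ψ`. -/
def pairing {g : SpaceTime n → ℝ} (hg : LocallyIntegrable g) : testFunctions n →ₗ[ℝ] ℝ where
  toFun ψ := ∫ p, g p * ψ.1 p
  map_add' ψ₁ ψ₂ := by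
    rw [← integral_add (integrable_mul_testFunction hg ψ₁) (integrable_mul_testFunction hg ψ₂)]
    congr 1
    funext p
    exact mul_add _ _ _
  map_smul' c ψ := by
    rw [RingHom.id_apply, smul_eq_mul, ← integral_const_mul]
    congr 1
    funext p
    exact mul_left_comm _ _ _

/-- The monomials of degree at most one in the space variable. -/
def affineMonomial (i : Option (Fin n)) (p : SpaceTime n) : ℝ :=
  i.elim 1 fun j => p.1 j

lemma continuous_affineMonomial (i : Option (Fin n)) : Continuous (affineMonomial i) := by
  cases i with
  | none => exact continuous_const
  | some j =>
    change Continuous fun p : SpaceTime n => p.1 j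
    fun_prop

/-- A solution is affine in space and constant in time. -/
theorem exists_ae_eq_affine {s : ℝ} (hs0 : 0 < s) (hs1 : s < 1) {u : SpaceTime n → ℝ}
    (hu : MemSlowlyIncreasing n s u) (hsol : IsDistributionalSolution n s u) :
    ∃ (a : ℝ) (b : EuclideanSpace ℝ (Fin n)), ∀ᵐ p : SpaceTime n, u p = a + inner ℝ b p.1 := by
  have hL : ∀ i : Option (Fin n), LocallyIntegrable (affineMonomial (n := n) i) volume :=
    fun i => (continuous_affineMonomial i).locallyIntegrable
  have hspan : pairing hu.1 ∈ Submodule.span ℝ (range fun i => pairing (hL i)) := by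
    -- Linear algebra replaces a regularity argument: it suffices that `u` annihilates every test
    -- function annihilated by `1` and the `x_j`.
    refine mem_span_of_iInf_ker_le_ker fun ψ hψ => ?_
    rw [Submodule.mem_iInf] at hψ
    have h0 := hψ none
    have hj : ∀ j, ∫ p : SpaceTime n, p.1 j * ψ.1 p = 0 := fun j => hψ (some j)
    refine integral_mul_eq_zero hs0 hs1 hu hsol ψ.2.1 ψ.2.2 (by
      simpa [pairing, affineMonomial] using h0) fun w => ?_
    have e : ∀ q : SpaceTime n, inner ℝ w q.1 * ψ.1 q = ∑ j, w j * (q.1 j * ψ.1 q) := by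
      intro q
      rw [PiLp.inner_apply, Finset.sum_mul]
      refine Finset.sum_congr rfl fun j _ => ?_
      simp
      ring
    simp_rw [e]
    have hi : ∀ j, Integrable fun q : SpaceTime n => q.1 j * ψ.1 q := fun j =>
      integrable_mul_testFunction (hL (some j)) ψ
    rw [integral_finsetSum _ fun j _ => (hi j).const_mul (w j)]
    refine Finset.sum_eq_zero fun j _ => ?_
    rw [integral_const_mul, hj, mul_zero]
  obtain ⟨c, hcsum⟩ := (Submodule.mem_span_range_iff_exists_fun ℝ).1 hspan
  set P : SpaceTime n → ℝ := fun p => ∑ i, c i * affineMonomial i p with hP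
  have hPc : Continuous P :=
    continuous_finsetSum _ fun i _ => continuous_const.mul (continuous_affineMonomial i)
  have hloc : LocallyIntegrable (fun p => u p - P p) volume :=
    hu.1.sub hPc.locallyIntegrable
  have hzero := ae_eq_zero_of_integral_contDiff_smul_eq_zero (μ := volume) hloc
    (fun g hg hgs => by
      let ψ : testFunctions n := ⟨g, hg, hgs⟩
      have h1 := congrArg (fun l : testFunctions n →ₗ[ℝ] ℝ => l ψ) hcsum
      simp only [LinearMap.sum_apply, LinearMap.smul_apply, smul_eq_mul] at h1
      have h2 : ∫ p, P p * g p = ∑ i, c i * pairing (hL i) ψ := by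
        have e : ∀ p, P p * g p = ∑ i, c i * (affineMonomial i p * g p) := fun p => by
          rw [hP, Finset.sum_mul]
          exact Finset.sum_congr rfl fun i _ => mul_assoc _ _ _
        simp_rw [e]
        rw [integral_finsetSum _ fun i _ =>
          (integrable_mul_testFunction (hL i) ψ).const_mul (c i)]
        exact Finset.sum_congr rfl fun i _ => integral_const_mul _ _
      have h3 : ∫ p, u p * g p = ∫ p, P p * g p := h2.symm ▸ h1.symm
      have e : ∀ p, g p • (u p - P p) = u p * g p - P p * g p := fun p => by
        rw [smul_eq_mul]; ring
      simp_rw [e]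
      rw [integral_sub (integrable_mul_testFunction hu.1 ψ)
        (integrable_mul_testFunction hPc.locallyIntegrable ψ), h3, sub_self])
  refine ⟨c none, WithLp.toLp 2 fun j => c (some j), ?_⟩
  filter_upwards [hzero] with p hp
  rw [sub_eq_zero.1 hp, hP]
  simp [Fintype.sum_option, affineMonomial, PiLp.inner_apply, mul_comm]

/-! ### Vanishing of the slope. -/

/-- Near the direction `-b` the affine function lies below `-(‖b‖ / 2) ‖x‖`, hence below `-(‖b‖ / 2)
‖x‖ ^ γ` for `‖x‖ > 1`. This happens on a nonempty open set outside any ball, so a null set of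
exceptions cannot hide it. -/
lemma inner_eq_zero_of_growth {γ : ℝ} (hγ : γ ≤ 1) {a : ℝ} {b : EuclideanSpace ℝ (Fin n)}
    (h : ∀ ε : ℝ, 0 < ε → ∀ᶠ x in essAtInfty n, -ε < (a + inner ℝ b x) / ‖x‖ ^ γ) : b = 0 := by
  by_contra hb
  have hb0 : 0 < ‖b‖ := norm_pos_iff.2 hb
  have h1 := h (‖b‖ / 2) (by positivity)
  rw [essAtInfty, eventually_inf] at h1
  obtain ⟨S, hS, A, hA, hSA⟩ := h1
  obtain ⟨R, -, hR⟩ := hasBasis_cobounded_norm.mem_iff.1 hS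
  let U : Set (EuclideanSpace ℝ (Fin n)) :=
    {x | max R 1 < ‖x‖ ∧ a + inner ℝ b x < -(‖b‖ / 2) * ‖x‖}
  have hU : IsOpen U := by
    have h2 : IsOpen {x : EuclideanSpace ℝ (Fin n) | a + inner ℝ b x < -(‖b‖ / 2) * ‖x‖} :=
      isOpen_lt (by fun_prop) (by fun_prop)
    exact (isOpen_lt continuous_const continuous_norm).inter h2
  have hne : U.Nonempty := by
    -- The first summand makes `‖l • b‖` exceed `max R 1`; the second makes `l ‖b‖² / 2` exceed `a`.
    set l : ℝ := (max R 1 + |a| + 1) / ‖b‖ + 2 * (|a| + 1) / ‖b‖ ^ 2 with hl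
    have hm : 1 ≤ max R 1 := le_max_right _ _
    have ha := abs_nonneg a
    have hl0 : 0 < l := by positivity
    have hlb : l * ‖b‖ = (max R 1 + |a| + 1) + 2 * (|a| + 1) / ‖b‖ := by
      rw [hl]; field_simp
    have hlb2 : l * ‖b‖ ^ 2 = (max R 1 + |a| + 1) * ‖b‖ + 2 * (|a| + 1) := by
      rw [hl]; field_simp
    refine ⟨-(l • b), ?_, ?_⟩
    · rw [norm_neg, norm_smul, Real.norm_of_nonneg hl0.le, hlb]
      have : 0 < 2 * (|a| + 1) / ‖b‖ := by positivity
      linarith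
    · rw [norm_neg, norm_smul, Real.norm_of_nonneg hl0.le, inner_neg_right, inner_smul_right,
        real_inner_self_eq_norm_sq]
      have : 0 ≤ (max R 1 + |a| + 1) * ‖b‖ := by positivity
      have := le_abs_self a
      nlinarith
  obtain ⟨x, hxU, hxA⟩ := (Measure.dense_of_ae (p := fun x => x ∈ A) hA).inter_open_nonempty U hU hne
  have hx1 : 1 < ‖x‖ := (le_max_right _ _).trans_lt hxU.1
  have h2 := hSA x ⟨hR ((le_max_left _ _).trans hxU.1.le), hxA⟩
  have hpow : 0 < ‖x‖ ^ γ := Real.rpow_pos_of_pos (by linarith) _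
  rw [lt_div_iff₀ hpow] at h2
  have h3 : ‖x‖ ^ γ ≤ ‖x‖ := by
    simpa using Real.rpow_le_rpow_of_exponent_le hx1.le hγ
  have h4 := hxU.2
  nlinarith

/-- One good time slice is enough, as the slope does not depend on `t`. The swap is needed for
Fubini to give almost every `t` first. -/
lemma exists_slice_ae_eq {u w : SpaceTime n → ℝ} (h : ∀ᵐ p, u p = w p) {Q : ℝ → Prop}
    (hQ : ∀ᵐ t, Q t) : ∃ t, Q t ∧ ∀ᵐ x, u (x, t) = w (x, t) := by
  have h1 : ∀ᵐ q : ℝ × EuclideanSpace ℝ (Fin n), u q.swap = w q.swap :=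
    Measure.measurePreserving_swap.quasiMeasurePreserving.ae h
  have h2 : ∀ᵐ t : ℝ, ∀ᵐ x, u (x, t) = w (x, t) := Measure.ae_ae_of_ae_prod h1
  exact (hQ.and h2).exists

lemma eq_zero_of_growthBelow {γ : ℝ} (hγ : γ ≤ 1) {u : SpaceTime n → ℝ} {a : ℝ}
    {b : EuclideanSpace ℝ (Fin n)} (hab : ∀ᵐ p : SpaceTime n, u p = a + inner ℝ b p.1)
    (hg : GrowthBelow n γ u) : b = 0 := by
  obtain ⟨t, ht, hx⟩ := exists_slice_ae_eq hab hg
  refine inner_eq_zero_of_growth hγ (a := a) fun ε hε => ?_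
  have h1 : ((-ε : ℝ) : EReal) <
      liminf (fun x => ((u (x, t) / ‖x‖ ^ γ : ℝ) : EReal)) (essAtInfty n) :=
    lt_of_lt_of_le (by exact_mod_cast neg_lt_zero.2 hε) ht
  have hx' : ∀ᶠ x in essAtInfty n, u (x, t) = a + inner ℝ b x := hx.filter_mono inf_le_right
  filter_upwards [eventually_lt_of_lt_liminf h1, hx'] with x h2 h3
  rw [h3] at h2
  exact_mod_cast h2

lemma eq_zero_of_growthAbove {γ : ℝ} (hγ : γ ≤ 1) {u : SpaceTime n → ℝ} {a : ℝ}
    {b : EuclideanSpace ℝ (Fin n)} (hab : ∀ᵐ p : SpaceTime n, u p = a + inner ℝ b p.1)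
    (hg : GrowthAbove n γ u) : b = 0 := by
  obtain ⟨t, ht, hx⟩ := exists_slice_ae_eq hab hg
  rw [← neg_eq_zero]
  refine inner_eq_zero_of_growth hγ (a := -a) fun ε hε => ?_
  have h1 : limsup (fun x => ((u (x, t) / ‖x‖ ^ γ : ℝ) : EReal)) (essAtInfty n) <
      ((ε : ℝ) : EReal) := lt_of_le_of_lt ht (by exact_mod_cast hε)
  have hx' : ∀ᶠ x in essAtInfty n, u (x, t) = a + inner ℝ b x := hx.filter_mono inf_le_right
  filter_upwards [eventually_lt_of_limsup_lt h1, hx'] with x h2 h3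
  rw [h3] at h2
  have h4 : (a + inner ℝ b x) / ‖x‖ ^ γ < ε := by exact_mod_cast h2
  rw [inner_neg_left, ← neg_add, neg_div]
  linarith

/-- A homogeneous function of degree `-n` is not integrable at infinity. -/
lemma eq_zero_of_integrableOn_inner {b : EuclideanSpace ℝ (Fin n)}
    (h : IntegrableOn (fun x => |inner ℝ b x| * (‖x‖ ^ (n + 1))⁻¹) {x | 1 < ‖x‖}) : b = 0 := by
  by_contra hb
  have hb0 : 0 < ‖b‖ := norm_pos_iff.2 hb
  set g : EuclideanSpace ℝ (Fin n) → ℝ := fun x => |inner ℝ b x| * (‖x‖ ^ (n + 1))⁻¹ with hg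
  have hg0 : ∀ x, 0 ≤ g x := fun x => by positivity
  have hS : ∀ r : ℝ, MeasurableSet {x : EuclideanSpace ℝ (Fin n) | r < ‖x‖} := fun r =>
    measurableSet_lt measurable_const measurable_norm
  have hsm : (2 : ℝ) • {x : EuclideanSpace ℝ (Fin n) | 1 < ‖x‖} = {x | 2 < ‖x‖} := by
    ext x
    rw [mem_smul_set_iff_inv_smul_mem₀ two_ne_zero, mem_ofPred_eq, mem_ofPred_eq, norm_smul,
      norm_inv, Real.norm_two]
    constructor <;> intro h <;> linarith
  have h2 := Measure.setIntegral_comp_smul (volume : Measure (EuclideanSpace ℝ (Fin n))) g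
    {x | 1 < ‖x‖} (two_ne_zero (α := ℝ))
  have hhom : ∀ x, g ((2 : ℝ) • x) = (2 ^ n)⁻¹ * g x := fun x => by
    simp only [hg]
    rw [inner_smul_right, abs_mul, norm_smul, Real.norm_two, abs_two, mul_pow, mul_inv, pow_succ]
    ring
  simp_rw [hhom] at h2
  rw [integral_const_mul, finrank_euclideanSpace_fin, abs_of_pos (by positivity), smul_eq_mul,
    hsm] at h2
  -- By homogeneity dilation by `2` preserves the integral, so the annulus between the two radii
  -- carries none of it. But `g` is positive on an open part of the annulus.
  have h3 : ∫ x in {x | 1 < ‖x‖}, g x = ∫ x in {x | 2 < ‖x‖}, g x :=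
    mul_left_cancel₀ (by positivity) h2
  have hsub : {x : EuclideanSpace ℝ (Fin n) | 2 < ‖x‖} ⊆ {x | 1 < ‖x‖} :=
    fun x (hx : 2 < ‖x‖) => show 1 < ‖x‖ by linarith
  have h4 : ∫ x in {x | 1 < ‖x‖} \ {x | 2 < ‖x‖}, g x = 0 := by
    rw [setIntegral_sdiff (hS 2) h hsub, h3, sub_self]
  have h5 := (setIntegral_eq_zero_iff_of_nonneg_ae (Eventually.of_forall hg0)
    (h.mono_set sdiff_subset)).1 h4
  have h6 := (ae_restrict_iff' ((hS 1).diff (hS 2))).1 h5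
  let U : Set (EuclideanSpace ℝ (Fin n)) := {x | (1 < ‖x‖ ∧ ‖x‖ < 2) ∧ 0 < inner ℝ b x}
  have hU : IsOpen U := by
    have h2 : IsOpen {x : EuclideanSpace ℝ (Fin n) | 0 < inner ℝ b x} :=
      isOpen_lt continuous_const (by fun_prop)
    exact ((isOpen_lt continuous_const continuous_norm).inter
      (isOpen_lt continuous_norm continuous_const)).inter h2
  have hne : U.Nonempty := by
    refine ⟨(3 / 2 / ‖b‖) • b, ?_, ?_⟩
    · rw [norm_smul, Real.norm_of_nonneg (by positivity), div_mul_cancel₀ _ hb0.ne']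
      norm_num
    · rw [inner_smul_right, real_inner_self_eq_norm_sq]
      positivity
  obtain ⟨x, hxU, hx⟩ := (Measure.dense_of_ae h6).inter_open_nonempty U hU hne
  have h7 : g x = 0 := hx ⟨hxU.1.1, not_lt.2 hxU.1.2.le⟩
  have h8 : 0 < g x := by
    have h1 : 0 < ‖x‖ := one_pos.trans hxU.1.1
    have h2 : 0 < |inner ℝ b x| := abs_pos.2 hxU.2.ne'
    positivity
  exact h8.ne' h7

/-- For `s ≤ 1/2` the slowly increasing affine functions of `x` are constant. -/
lemma eq_zero_of_integrable_weight {s : ℝ} (hs0 : 0 < s) (hs : s ≤ 1 / 2) {a : ℝ}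
    {b : EuclideanSpace ℝ (Fin n)}
    (h : Integrable fun p : SpaceTime n => |a + inner ℝ b p.1| / weight n s p) : b = 0 := by
  have hS : MeasurableSet {x : EuclideanSpace ℝ (Fin n) | 1 < ‖x‖} :=
    measurableSet_lt measurable_const measurable_norm
  set g : EuclideanSpace ℝ (Fin n) → ℝ := fun x => |a + inner ℝ b x| * (‖x‖ ^ (n + 1))⁻¹ with hg
  have hgm : Measurable g := by
    rw [hg]; fun_prop
  -- In the parabolic region `0 < t ≤ ‖x‖²` each term of the weight is at most `‖x‖^(n+3)`; here `s
  -- ≤ 1/2` enters. Integrating over these `t` contributes `‖x‖²` and leaves `‖x‖^(-(n+1))`.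
  have hlow : ∀ x : EuclideanSpace ℝ (Fin n), 1 < ‖x‖ → ∀ t ∈ Ioc 0 (‖x‖ ^ 2),
      |a + inner ℝ b x| / (3 * ‖x‖ ^ (n + 3)) ≤
        |a + inner ℝ b x| / weight n s (x, t) := by
    intro x hx t ht
    have hx0 : 0 < ‖x‖ := by linarith
    refine div_le_div_of_nonneg_left (abs_nonneg _) (weight_pos s _) ?_
    have h1 : ‖x‖ ^ ((n : ℝ) + 2 + 2 * s) ≤ ‖x‖ ^ (n + 3) := by
      rw [← Real.rpow_natCast]
      refine Real.rpow_le_rpow_of_exponent_le hx.le ?_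
      push_cast
      linarith
    have h2 : |t| ^ ((n : ℝ) / 2 + 1 + s) ≤ ‖x‖ ^ (n + 3) := by
      refine le_trans ?_ h1
      rw [abs_of_pos ht.1]
      calc t ^ ((n : ℝ) / 2 + 1 + s) ≤ (‖x‖ ^ 2) ^ ((n : ℝ) / 2 + 1 + s) :=
            Real.rpow_le_rpow ht.1.le ht.2 (by positivity)
        _ = _ := by
          rw [← Real.rpow_natCast, ← Real.rpow_mul hx0.le]
          congr 1
          push_cast
          ring
    have h3 : (1 : ℝ) ≤ ‖x‖ ^ (n + 3) := one_le_pow₀ hx.le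
    unfold weight
    linarith
  have hgi : IntegrableOn g {x | 1 < ‖x‖} := by
    have hI : Integrable fun x => ∫ t, |a + inner ℝ b x| / weight n s (x, t) :=
      h.integral_prod_left
    refine (hI.const_mul 3).integrableOn.mono' hgm.aestronglyMeasurable ?_
    rw [ae_restrict_iff' hS]
    have hsl : ∀ᵐ x : EuclideanSpace ℝ (Fin n),
      Integrable fun t : ℝ => |a + inner ℝ b x| / weight n s (x, t) := h.prod_right_ae
    filter_upwards [hsl] with x hx hx1
    have hx0 : 0 < ‖x‖ := lt_trans one_pos hx1
    have h1 : ∫ t in Ioc 0 (‖x‖ ^ 2), |a + inner ℝ b x| / (3 * ‖x‖ ^ (n + 3)) ≤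
        ∫ t in Ioc 0 (‖x‖ ^ 2), |a + inner ℝ b x| / weight n s (x, t) :=
      setIntegral_mono_on (integrableOn_const (by simp) (by simp)) hx.integrableOn
        measurableSet_Ioc (hlow x hx1)
    have h2 : ∫ t in Ioc 0 (‖x‖ ^ 2), |a + inner ℝ b x| / weight n s (x, t) ≤
        ∫ t, |a + inner ℝ b x| / weight n s (x, t) :=
      setIntegral_le_integral hx (Eventually.of_forall fun t =>
        div_nonneg (abs_nonneg _) (weight_pos s _).le)
    rw [setIntegral_const, Real.volume_real_Ioc_of_le (by positivity), smul_eq_mul] at h1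
    rw [Real.norm_of_nonneg (by positivity)]
    calc g x = 3 * ((‖x‖ ^ 2 - 0) * (|a + inner ℝ b x| / (3 * ‖x‖ ^ (n + 3)))) := by
          rw [hg]; field_simp; ring
      _ ≤ _ := by linarith
  -- Adding the reflection `x ↦ -x` eliminates the constant `a`.
  have hgi' : IntegrableOn (fun x => g (-x)) {x | 1 < ‖x‖} := by
    have h1 := ((integrable_indicator_iff hS).2 hgi).comp_neg
    rw [← integrable_indicator_iff hS]
    refine h1.congr (Eventually.of_forall fun x => ?_)
    by_cases hx : 1 < ‖x‖ <;> simp [indicator, hx]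
  refine eq_zero_of_integrableOn_inner ((hgi.add hgi').mono' ?_ (Eventually.of_forall fun x => ?_))
  · exact Measurable.aestronglyMeasurable (by fun_prop)
  · rw [Real.norm_of_nonneg (by positivity)]
    simp only [hg, Pi.add_apply, norm_neg, inner_neg_right]
    rw [← add_mul]
    refine mul_le_mul_of_nonneg_right ?_ (by positivity)
    rw [abs_le]
    constructor
    · linarith [neg_abs_le (a + inner ℝ b x), le_abs_self (a + -inner ℝ b x),
        le_abs_self (a + inner ℝ b x), neg_abs_le (a + -inner ℝ b x)]
    · linarith [neg_abs_le (a + inner ℝ b x), le_abs_self (a + -inner ℝ b x),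
        le_abs_self (a + inner ℝ b x), neg_abs_le (a + -inner ℝ b x)]

end MasterEquation

end

/-! ### The Liouville theorem. -/

theorem theorem1p1 (n : ℕ) (hn : 2 ≤ n) (s : ℝ) (hs0 : 0 < s) (hs1 : s < 1)
    (u : MasterEquation.SpaceTime n → ℝ)
    (hu : MasterEquation.MemSlowlyIncreasing n s u)
    (hsol : MasterEquation.IsDistributionalSolution n s u)
    (hgrowth : 1 / 2 < s → ∃ γ : ℝ, 0 ≤ γ ∧ γ ≤ 1 ∧
      (MasterEquation.GrowthBelow n γ u ∨ MasterEquation.GrowthAbove n γ u)) :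
    ∃ c : ℝ, ∀ᵐ p : MasterEquation.SpaceTime n, u p = c := by
  obtain ⟨a, b, hab⟩ := MasterEquation.exists_ae_eq_affine hs0 hs1 hu hsol
  have hb : b = 0 := by
    rcases le_or_gt s (1 / 2) with hs | hs
    · refine MasterEquation.eq_zero_of_integrable_weight (a := a) hs0 hs (hu.2.congr ?_)
      filter_upwards [hab] with p hp
      rw [hp]
    · obtain ⟨γ, -, hγ1, hg | hg⟩ := hgrowth hs
      · exact MasterEquation.eq_zero_of_growthBelow hγ1 hab hg
      · exact MasterEquation.eq_zero_of_growthAbove hγ1 hab hg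
  refine ⟨a, ?_⟩
  filter_upwards [hab] with p hp
  simpa [hb] using hp
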